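/- **Model.** Let $A=\{1,\dots,n\}$ be a set of actions. Action $a$ has cost $c(a)>0$, and costs are additive: $c(S)=\sum_{a\in S}c(a)$. A success probability function is a map $f:2^A\to[0,1]$ with $f(\emptyset)=0$ and $f(S)\le f(S')$ whenever $S\subseteq S'$. The principal's reward is $1$ on success and $0$ on failure. A contract $t$ consists of payments $t(0),t(1)\ge 0$ to the agent on failure and on success. With $T(S)=(1-f(S))\,t(0)+f(S)\,t(1)$, the agent's utility from $S$ is $T(S)-c(S)$ and the principal's utility is $f(S)-T(S)$. The agent chooses a set $S$ that maximizes his utility, breaking ties in favor of the principal; $u_p(t)$ is the resulting utility of the principal. A contract is optimal if it maximizes $u_p$ among all contracts. The function $f$ is gross substitutes if for all price vectors $p,q\in\mathbb{R}^n_{\ge 0}$ with $p\le q$ and every $S$ maximizing $f(S)-\sum_{i\in S}p_i$ there is a $T$ maximizing $f(T)-\sum_{i\in T}q_i$ with $\{i\in S: q_i=p_i\}\subseteq T$. The computational model is a random access machine with integer registers, integer arrays and real arrays, with integers as its only constants. At unit cost it performs integer addition and truncated subtraction, accesses to memory, the four arithmetic operations on reals, comparisons, and value queries (which return $f(S)$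 for a set $S$ given by its indicator vector in memory). The input is $n$ and $c$; $f$ is accessible only through value queries. **Theorem.** There is a single program (independent of $n$, $f$ and $c$) and a polynomial $p$ such that for every $n\ge 0$, every gross substitutes success probability function $f$ and every cost function $c>0$ on $n$ actions, the program halts after at most $p(n)$ steps (hence after at most $p(n)$ value queries) and outputs a number $\alpha\in[0,1]$ such that the contract $t(0)=0$, $t(1)=\alpha$ is optimal. Moreover, the computation is strongly polynomial also in the sense of bit lengths: there is a polynomial $s$ such that, if all values $f(S)$ and $c(a)$ are rational with numerators and denominators (in lowest terms) of at most $L$ binary digits, then all numbers stored in the real arrays at any time of the computation are rational with numerators and denominators of at most $s(n+L)$ binary digits. -/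

import Mathlib

open scoped NNReal BigOperators

/-! ### The principal-agent model

The actions are the elements of `Fin n`; `f S` is the probability that the project succeeds when the
agent takes the set `S` of actions, and `c a` is the cost of the action `a`.  The principal's reward
is `1` on success and `0` on failure. -/

namespace CombinatorialContracts

/-- A success probability function: values in `[0, 1]`, normalized, monotonically non-decreasing. -/
structure IsSuccessProbability {n : ℕ} (f : Finset (Fin n) → ℝ) : Prop where
  nonneg : ∀ S, 0 ≤ f S
  le_one : ∀ S, f S ≤ 1
  empty : f ∅ = 0
  mono : ∀ S S' : Finset (Fin n), S ⊆ S' → f S ≤ f S'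

/-- `S` maximizes the utility `f S - ∑ i ∈ S, p i` at prices `p`. -/
def InDemandAtPrices {n : ℕ} (f : Finset (Fin n) → ℝ) (p : Fin n → ℝ) (S : Finset (Fin n)) : Prop :=
  ∀ S' : Finset (Fin n), f S' - ∑ i ∈ S', p i ≤ f S - ∑ i ∈ S, p i

/-- Gross substitutes: if prices rise from `p` to `q`, then for each set `S` in demand at `p` some
set in demand at `q` still contains all elements of `S` whose price did not change. -/
def GrossSubstitutes {n : ℕ} (f : Finset (Fin n) → ℝ) : Prop :=
  ∀ p q : Fin n → ℝ, (∀ i, 0 ≤ p i) → (∀ i, p i ≤ q i) →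
    ∀ S : Finset (Fin n), InDemandAtPrices f p S →
      ∃ T : Finset (Fin n), InDemandAtPrices f q T ∧ ∀ i ∈ S, q i = p i → i ∈ T

/-- A contract: non-negative payments from the principal to the agent, for either outcome. -/
structure Contract where
  onFailure : ℝ≥0
  onSuccess : ℝ≥0

/-- The contract that pays `α` on success and nothing on failure. -/
def Contract.linear (α : ℝ≥0) : Contract := ⟨0, α⟩

section Utilities

variable {n : ℕ} (f : Finset (Fin n) → ℝ) (c : Fin n → ℝ)

/-- Expected payment `T(S)`. -/
noncomputable def expectedPayment (t : Contract) (S : Finset (Fin n)) : ℝ :=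
  (1 - f S) * (t.onFailure : ℝ) + f S * (t.onSuccess : ℝ)

/-- The agent's expected utility `T(S) - c(S)`; costs are additive. -/
noncomputable def agentUtility (t : Contract) (S : Finset (Fin n)) : ℝ :=
  expectedPayment f t S - ∑ a ∈ S, c a

/-- The principal's expected utility `f(S) - T(S)`. -/
noncomputable def principalUtility (t : Contract) (S : Finset (Fin n)) : ℝ :=
  f S - expectedPayment f t S

open Classical in
/-- The sets of actions that maximize the agent's utility under `t`. -/
noncomputable def demand (t : Contract) : Finset (Finset (Fin n)) :=
  Finset.univ.filter fun S => ∀ S', agentUtility f c t S' ≤ agentUtility f c t S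

open Classical in
/-- The best responses to `t`: the agent breaks ties in favor of the principal. -/
noncomputable def bestResponses (t : Contract) : Finset (Finset (Fin n)) :=
  (demand f c t).filter fun S => ∀ S' ∈ demand f c t, principalUtility f t S' ≤ principalUtility f t S

theorem demand_nonempty (t : Contract) : (demand f c t).Nonempty := by
  obtain ⟨S, -, hS⟩ := Finset.exists_max_image Finset.univ (agentUtility f c t)
    (Finset.univ_nonempty (α := Finset (Fin n)))
  exact ⟨S, by simpa [demand] using fun S' => hS S' (Finset.mem_univ _)⟩

/-- The principal's utility `u_p(t)` from a contract: the one she obtains from any best response of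
the agent (see `principalUtility_of_mem_bestResponses`), that is, the largest one that she obtains
from a set in the agent's demand. -/
noncomputable def principalValue (t : Contract) : ℝ :=
  (demand f c t).sup' (demand_nonempty f c t) (principalUtility f t)

theorem bestResponses_nonempty (t : Contract) : (bestResponses f c t).Nonempty := by
  obtain ⟨S, hS, hmax⟩ := Finset.exists_max_image (demand f c t) (principalUtility f t)
    (demand_nonempty f c t)
  exact ⟨S, by simpa [bestResponses] using ⟨hS, hmax⟩⟩

theorem principalUtility_of_mem_bestResponses (t : Contract) (S : Finset (Fin n))
    (hS : S ∈ bestResponses f c t) : principalUtility f t S = principalValue f c t := by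
  rw [bestResponses, Finset.mem_filter] at hS
  exact le_antisymm (Finset.le_sup' _ hS.1) (Finset.sup'_le _ _ hS.2)

/-- `t` is optimal: it maximizes the principal's utility among all contracts. -/
def IsOptimalContract (t : Contract) : Prop :=
  ∀ t' : Contract, principalValue f c t' ≤ principalValue f c t

end Utilities

/-! ### The machine model

A random access machine over the reals with a value oracle.  Its memory consists of integer
registers, integer arrays and real arrays.  A program is a finite term of a while-language.  Every
step carries out at most one operation: one integer operation, one memory access, one arithmetic
operation on reals, one comparison or one oracle call.  The only constants are integers. -/

/-- The contents of the memory. -/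
structure Memory where
  reg : ℕ → ℕ
  arr : ℕ → ℕ → ℕ
  real : ℕ → ℕ → ℝ

/-- A reference to a real number in memory: the entry of the real array number `array` whose
position is the current content of the integer register number `index`. -/
structure Cell where
  array : ℕ
  index : ℕ

namespace Memory

def get (m : Memory) (d : Cell) : ℝ := m.real d.array (m.reg d.index)

def setReg (m : Memory) (x v : ℕ) : Memory :=
  { m with reg := Function.update m.reg x v }

def setArr (m : Memory) (a i v : ℕ) : Memory :=
  { m with arr := Function.update m.arr a (Function.update (m.arr a) i v) }

def set (m : Memory) (d : Cell) (v : ℝ) : Memory where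
  reg := m.reg
  arr := m.arr
  real := Function.update m.real d.array (Function.update (m.real d.array) (m.reg d.index) v)

/-- The set of actions whose indicator vector is stored in the integer array number `a`. -/
def actionSet (m : Memory) (n a : ℕ) : Finset (Fin n) :=
  Finset.univ.filter fun i => m.arr a i ≠ 0

end Memory

/-- The basic instructions. -/
inductive Instruction where
  /-- `reg x := k` -/
  | const (x k : ℕ)
  /-- `reg x := reg y + reg z` -/
  | add (x y z : ℕ)
  /-- `reg x := max (reg y - reg z) 0` -/
  | sub (x y z : ℕ)
  /-- `reg x := arr a [reg i]` -/
  | load (x a i : ℕ)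
  /-- `arr a [reg i] := reg x` -/
  | store (a i x : ℕ)
  /-- `d := k` -/
  | realConst (d : Cell) (k : ℤ)
  /-- `d := u` -/
  | realCopy (d u : Cell)
  /-- `d := u + v` -/
  | realAdd (d u v : Cell)
  /-- `d := u - v` -/
  | realSub (d u v : Cell)
  /-- `d := u * v` -/
  | realMul (d u v : Cell)
  /-- `d := u / v`, where division by zero yields zero -/
  | realDiv (d u v : Cell)
  /-- `d := f S`, where `S` is the set of actions stored in the integer array `a` -/
  | query (d : Cell) (a : ℕ)

/-- The effect of an instruction, when the value oracle is `f`. -/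
noncomputable def Instruction.exec {n : ℕ} (f : Finset (Fin n) → ℝ) :
    Instruction → Memory → Memory
  | .const x k, m => m.setReg x k
  | .add x y z, m => m.setReg x (m.reg y + m.reg z)
  | .sub x y z, m => m.setReg x (m.reg y - m.reg z)
  | .load x a i, m => m.setReg x (m.arr a (m.reg i))
  | .store a i x, m => m.setArr a (m.reg i) (m.reg x)
  | .realConst d k, m => m.set d k
  | .realCopy d u, m => m.set d (m.get u)
  | .realAdd d u v, m => m.set d (m.get u + m.get v)
  | .realSub d u v, m => m.set d (m.get u - m.get v)
  | .realMul d u v, m => m.set d (m.get u * m.get v)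
  | .realDiv d u v, m => m.set d (m.get u / m.get v)
  | .query d a, m => m.set d (f (m.actionSet n a))

/-- The tests: comparisons of integer registers or of real cells. -/
inductive Test where
  | lt (x y : ℕ)
  | le (x y : ℕ)
  | realLt (u v : Cell)
  | realLe (u v : Cell)

def Test.Holds : Test → Memory → Prop
  | .lt x y, m => m.reg x < m.reg y
  | .le x y, m => m.reg x ≤ m.reg y
  | .realLt u v, m => m.get u < m.get v
  | .realLe u v, m => m.get u ≤ m.get v

/-- Programs of the while-language. -/
inductive Program where
  | skip
  | basic (i : Instruction)
  | seq (P Q : Program)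
  | ite (b : Test) (P Q : Program)
  | loop (b : Test) (P : Program)

/-- A configuration: the programs that remain to be executed, in this order, and the memory. -/
structure Config where
  todo : List Program
  mem : Memory

open Classical in
/-- One step of the machine with value oracle `f`. -/
noncomputable def Config.step {n : ℕ} (f : Finset (Fin n) → ℝ) : Config → Config
  | ⟨[], m⟩ => ⟨[], m⟩
  | ⟨.skip :: k, m⟩ => ⟨k, m⟩
  | ⟨.basic i :: k, m⟩ => ⟨k, i.exec f m⟩
  | ⟨.seq P Q :: k, m⟩ => ⟨P :: Q :: k, m⟩
  | ⟨.ite b P Q :: k, m⟩ => if b.Holds m then ⟨P :: k, m⟩ else ⟨Q :: k, m⟩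
  | ⟨.loop b P :: k, m⟩ => if b.Holds m then ⟨P :: .loop b P :: k, m⟩ else ⟨k, m⟩

/-- The initial memory: `reg 0` holds the number `n` of actions, the real array `0` holds the costs
`c 0, …, c (n - 1)`, and all else is zero. -/
noncomputable def Memory.initial {n : ℕ} (c : Fin n → ℝ) : Memory where
  reg x := if x = 0 then n else 0
  arr _ _ := 0
  real r i := if h : r = 0 ∧ i < n then c ⟨i, h.2⟩ else 0

/-- The configuration reached from the input `n`, `c` after `T` steps of the program `P`, when the
value oracle is `f`. -/
noncomputable def Program.run (P : Program) {n : ℕ} (f : Finset (Fin n) → ℝ) (c : Fin n → ℝ)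
    (T : ℕ) : Config :=
  (Config.step f)^[T] ⟨[P], Memory.initial c⟩

def Config.Halted (C : Config) : Prop := C.todo = []

/-- The output: the real array `1` at position `0`. -/
def Config.output (C : Config) : ℝ := C.mem.real 1 0

/-- `x` is a rational number whose numerator and denominator, in lowest terms, have at most `L`
binary digits each. -/
def HasBitLength (x : ℝ) (L : ℕ) : Prop :=
  ∃ q : ℚ, (q : ℝ) = x ∧ Nat.size q.num.natAbs ≤ L ∧ Nat.size q.den ≤ L

end CombinatorialContracts

/-!
Only contracts that pay `α ∈ [0, 1]` on success and nothing on failure matter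
(`principalValue_le_of_linear`).  As `α` rises, the agent moves to sets of higher success
probability, and it is optimal for the principal to stop at a critical `α`, at which such a move has
just become worthwhile.  The program enumerates enough critical payments by a local search.

For gross substitutes, a set that no single addition, removal or swap improves is in demand
(`GrossSubstitutes.inDemandAtPrices_of_local`).  Hence a set `S` in demand at `α` stays in demand
until the agent becomes indifferent between `S` and a more successful set `T` that arises by adding
an item or swapping two (`InLinearDemand.of_le_exchangeRatio`).  The search moves to such a `T`, at
the payment `(c T - c S) / (f T - f S)`, which is the least of these ratios.  Then `T` costs more
than `S`, so every move adds an item or replaces one by a more expensive one, and the sum of the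
ranks of the items in the order of costs increases (`SearchInvariant.move`).  This sum is at most
`n * n`, also when costs or ratios are tied; so after `n * n` rounds no move is left, and the best
payment seen is optimal (`SearchInvariant.isOptimalContract`).

The running time of the program is established in a Hoare logic with time bounds
(`searchProgram_triple`).  The bit lengths follow from the shape of the program alone
(`Program.Levelled.fractionBound_run`): every real array has a level, arithmetic always leads to a
higher level, and there are five levels, so all numbers are expressions of bounded size in the data.
-/

namespace CombinatorialContracts

/-! ### The single improvement property -/

section SingleImprovement

variable {n : ℕ} {f : Finset (Fin n) → ℝ}

/-- Gross substitutes relative to an interval `[I, U]` of sets.  The items of `I` are made free and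
the items outside `U` prohibitively expensive, so that only the interval matters. -/
theorem GrossSubstitutes.exists_isMax_interval (hf : IsSuccessProbability f)
    (hgs : GrossSubstitutes f) {p q : Fin n → ℝ} (hp : ∀ i, 0 ≤ p i) (hpq : ∀ i, p i ≤ q i)
    {I U Y : Finset (Fin n)} (hIU : I ⊆ U) (hIY : I ⊆ Y) (hYU : Y ⊆ U)
    (hY : ∀ X, I ⊆ X → X ⊆ U → f X - ∑ i ∈ X, p i ≤ f Y - ∑ i ∈ Y, p i) :
    ∃ X, I ⊆ X ∧ X ⊆ U ∧
      (∀ Z, I ⊆ Z → Z ⊆ U → f Z - ∑ i ∈ Z, q i ≤ f X - ∑ i ∈ X, q i) ∧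
      ∀ i ∈ Y, q i = p i → i ∈ X := by
  let ext : (Fin n → ℝ) → Fin n → ℝ :=
    fun r i => if i ∈ I then 0 else if i ∈ U then r i else r i + 2
  let clip : Finset (Fin n) → Finset (Fin n) := fun X => X ∩ U ∪ I
  have hclipI : ∀ X, I ⊆ clip X := fun X => Finset.subset_union_right
  have hclipU : ∀ X, clip X ⊆ U := fun X => Finset.union_subset Finset.inter_subset_right hIU
  have hsum : ∀ r : Fin n → ℝ, ∀ X, I ⊆ X → X ⊆ U →
      ∑ i ∈ X, ext r i = ∑ i ∈ X, r i - ∑ i ∈ I, r i := by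
    intro r X h1 h2
    rw [← Finset.sum_sdiff h1, ← Finset.sum_sdiff h1]
    have e1 : ∑ i ∈ I, ext r i = 0 := Finset.sum_eq_zero fun i hi => by simp [ext, hi]
    have e2 : ∑ i ∈ X \ I, ext r i = ∑ i ∈ X \ I, r i := Finset.sum_congr rfl fun i hi => by
      rw [Finset.mem_sdiff] at hi
      simp [ext, hi.2, h2 hi.1]
    rw [e1, e2]; ring
  -- Clipping a set to the interval `[I, U]` never hurts at the prices `ext r`.
  have hclip : ∀ r : Fin n → ℝ, (∀ i, 0 ≤ r i) → ∀ X,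
      f X - ∑ i ∈ X, ext r i ≤ f (clip X) - ∑ i ∈ clip X, ext r i := by
    intro r hr X
    have hext : ∀ i, 0 ≤ ext r i := fun i => by
      have := hr i
      simp only [ext]
      split_ifs <;> linarith
    have e1 : ∑ i ∈ clip X, ext r i ≤ ∑ i ∈ X ∩ U, ext r i := by
      have h0 : ∑ i ∈ clip X, ext r i = ∑ i ∈ (X ∩ U) \ I, ext r i + ∑ i ∈ I, ext r i := by
        rw [← Finset.sum_sdiff (hclipI X)]
        congr 2
        ext i
        simp only [clip, Finset.mem_sdiff, Finset.mem_union]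
        tauto
      have h1 : ∑ i ∈ I, ext r i = 0 := Finset.sum_eq_zero fun i hi => by simp [ext, hi]
      rw [h0, h1, add_zero]
      exact Finset.sum_le_sum_of_subset_of_nonneg Finset.sdiff_subset fun i _ _ => hext i
    have e2 : f (X ∩ U) ≤ f (clip X) := hf.mono _ _ Finset.subset_union_left
    have e3 : ∑ i ∈ X \ U, ext r i + ∑ i ∈ X ∩ U, ext r i = ∑ i ∈ X, ext r i := by
      rw [add_comm]; exact Finset.sum_inter_add_sum_sdiff X U _
    by_cases hX : X ⊆ U
    · rw [Finset.inter_eq_left.2 hX] at e1 e2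
      linarith
    · obtain ⟨j, hjX, hjU⟩ := Finset.not_subset.1 hX
      have h2 : ext r j ≤ ∑ i ∈ X \ U, ext r i :=
        Finset.single_le_sum (fun i _ => hext i) (Finset.mem_sdiff.2 ⟨hjX, hjU⟩)
      have h3 : ext r j = r j + 2 := by
        have hjI : j ∉ I := fun h => hjU (hIU h)
        simp [ext, hjU, hjI]
      have := hr j
      have := hf.le_one X
      have := hf.nonneg (clip X)
      linarith
  obtain ⟨X, hX, hXY⟩ := hgs (ext p) (ext q)
    (fun i => by have := hp i; simp only [ext]; split_ifs <;> linarith)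
    (fun i => by have := hpq i; simp only [ext]; split_ifs <;> linarith) Y (by
      intro X
      refine (hclip p hp X).trans ?_
      rw [hsum p _ (hclipI X) (hclipU X), hsum p Y hIY hYU]
      have := hY _ (hclipI X) (hclipU X)
      linarith)
  refine ⟨clip X, hclipI X, hclipU X, fun Z h1 h2 => ?_, fun i hi hpqi => ?_⟩
  · have e1 := hX Z
    have e2 := hclip q (fun i => (hp i).trans (hpq i)) X
    rw [hsum q _ (hclipI X) (hclipU X)] at e2
    rw [hsum q _ h1 h2] at e1
    linarith
  · have : i ∈ X := hXY i hi (by simp only [ext, hpqi])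
    exact Finset.mem_union_left _ (Finset.mem_inter.2 ⟨this, hYU hi⟩)

/-- The single improvement property of gross substitutes: a set that cannot be improved by adding
at most one item and removing at most one item is in demand.  A better set `T` as close as possible
to `S` is the unique optimum of the interval `[S ∩ T, S ∪ T]`, and `S` is a runner-up.  If `T \ S`
had two items, then `T` would have to keep one of them when the other one becomes expensive; if
`S \ T` had two, then `S`, which is optimal when one of them is free, would have to keep the other
when that price is raised again. -/
theorem GrossSubstitutes.inDemandAtPrices_of_local (hf : IsSuccessProbability f)
    (hgs : GrossSubstitutes f) {p : Fin n → ℝ} (hp : ∀ i, 0 ≤ p i) {S : Finset (Fin n)}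
    (hS : ∀ T : Finset (Fin n), (T \ S).card ≤ 1 → (S \ T).card ≤ 1 →
      f T - ∑ i ∈ T, p i ≤ f S - ∑ i ∈ S, p i) :
    InDemandAtPrices f p S := by
  by_contra hcon
  simp only [InDemandAtPrices, not_forall, not_le] at hcon
  obtain ⟨T₀, hT₀⟩ := hcon
  obtain ⟨T, hTmem, hmin⟩ := Finset.exists_min_image
    (Finset.univ.filter fun T => f S - ∑ i ∈ S, p i < f T - ∑ i ∈ T, p i)
    (fun T => (T \ S).card + (S \ T).card) ⟨T₀, by simpa using hT₀⟩
  have hT : f S - ∑ i ∈ S, p i < f T - ∑ i ∈ T, p i := by simpa using hTmem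
  have hIS : S ∩ T ⊆ S := Finset.inter_subset_left
  have hIT : S ∩ T ⊆ T := Finset.inter_subset_right
  have hSU : S ⊆ S ∪ T := Finset.subset_union_left
  have hTU : T ⊆ S ∪ T := Finset.subset_union_right
  have hother : ∀ X, S ∩ T ⊆ X → X ⊆ S ∪ T → X ≠ T →
      f X - ∑ i ∈ X, p i ≤ f S - ∑ i ∈ S, p i := by
    intro X h1 h2 hne
    by_contra hlt
    have hd := hmin X (by rw [Finset.mem_filter]; exact ⟨Finset.mem_univ _, not_le.1 hlt⟩)
    have s1 : X \ S ⊆ T \ S := fun i hi => by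
      have := @h2 i
      simp only [Finset.mem_sdiff, Finset.mem_union] at *
      tauto
    have s2 : S \ X ⊆ S \ T := fun i hi => by
      have := @h1 i
      simp only [Finset.mem_sdiff, Finset.mem_inter] at *
      tauto
    have c1 := Finset.card_le_card s1
    have c2 := Finset.card_le_card s2
    have q1 := Finset.eq_of_subset_of_card_le s1 (by omega)
    have q2 := Finset.eq_of_subset_of_card_le s2 (by omega)
    apply hne
    ext i
    have h3 := Finset.ext_iff.1 q1 i
    have h4 := Finset.ext_iff.1 q2 i
    simp only [Finset.mem_sdiff] at h3 h4
    tauto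
  have hcases : 1 < (T \ S).card ∨ 1 < (S \ T).card := by
    by_contra h
    push Not at h
    exact absurd (hS T h.1 h.2) (not_le.2 hT)
  rcases hcases with h | h
  · obtain ⟨b, hb, b', hb', hbb⟩ := Finset.one_lt_card.1 h
    rw [Finset.mem_sdiff] at hb hb'
    set δ := (f T - ∑ i ∈ T, p i) - (f S - ∑ i ∈ S, p i) with hδ
    have hδ0 : 0 < δ := sub_pos.2 hT
    -- The surcharge `ε` on all of `T \ S` breaks ties in favor of `S`, but leaves `T` optimal.
    let ε : ℝ := δ / (n + 1)
    have hn : (0 : ℝ) < n + 1 := by positivity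
    have hε0 : 0 < ε := div_pos hδ0 hn
    have hεn : ε * n ≤ δ := by
      have : ε * (n + 1) = δ := div_mul_cancel₀ _ hn.ne'
      nlinarith
    let e : Fin n → ℝ := fun i => if i ∈ T \ S then ε else 0
    have he0 : ∀ i, 0 ≤ e i := fun i => by simp only [e]; split_ifs <;> linarith
    -- The surcharge `g` makes `b` too expensive for any optimal set.
    let g : Fin n → ℝ := fun i => if i = b then δ + 1 else 0
    have hg0 : ∀ i, 0 ≤ g i := fun i => by simp only [g]; split_ifs <;> linarith
    have heX : ∀ X, 0 ≤ ∑ i ∈ X, e i := fun X => Finset.sum_nonneg fun i _ => he0 i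
    have hgX : ∀ X, 0 ≤ ∑ i ∈ X, g i := fun X => Finset.sum_nonneg fun i _ => hg0 i
    have heS : ∑ i ∈ S, e i = 0 := Finset.sum_eq_zero fun i hi => by simp [e, hi]
    have hgS : ∑ i ∈ S, g i = 0 := Finset.sum_eq_zero fun i hi => by
      have : i ≠ b := fun h => hb.2 (h ▸ hi)
      simp [g, this]
    have heT : ∑ i ∈ T, e i ≤ δ := by
      have h1 : ∑ i ∈ T, e i ≤ ∑ _i ∈ T, ε := Finset.sum_le_sum fun i _ => by
        simp only [e]; split_ifs <;> linarith
      have h2 : (T.card : ℝ) ≤ n := by exact_mod_cast card_finset_fin_le T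
      rw [Finset.sum_const, nsmul_eq_mul] at h1
      nlinarith
    obtain ⟨X, hX1, hX2, hXmax, hXT⟩ := hgs.exists_isMax_interval hf
      (p := fun i => p i + e i) (q := fun i => p i + e i + g i) (I := S ∩ T) (U := S ∪ T) (Y := T)
      (fun i => add_nonneg (hp i) (he0 i)) (fun i => by have := hg0 i; linarith)
      (hIS.trans hSU) hIT hTU (by
        intro X h1 h2
        simp only [Finset.sum_add_distrib]
        rcases eq_or_ne X T with rfl | hne
        · exact le_rfl
        · have := hother X h1 h2 hne
          have := heX X
          linarith)
    have hmax := hXmax S hIS hSU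
    simp only [Finset.sum_add_distrib, heS, hgS] at hmax
    have heXX := heX X
    have hgXX := hgX X
    have hvX : f X - ∑ i ∈ X, p i ≤ f T - ∑ i ∈ T, p i := by
      rcases eq_or_ne X T with rfl | hne
      · exact le_rfl
      · exact (hother X hX1 hX2 hne).trans hT.le
    by_cases hbX : b ∈ X
    · have : g b ≤ ∑ i ∈ X, g i := Finset.single_le_sum (fun i _ => hg0 i) hbX
      simp only [g, if_true] at this
      linarith
    · have hb'X : b' ∈ X := hXT b' hb'.1 (by simp [g, hbb.symm])
      have : e b' ≤ ∑ i ∈ X, e i := Finset.single_le_sum (fun i _ => he0 i) hb'X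
      have he' : e b' = ε := if_pos (Finset.mem_sdiff.2 hb')
      have := hother X hX1 hX2 (fun h => hbX (h ▸ hb.1))
      linarith
  · obtain ⟨a, ha, a', ha', haa⟩ := Finset.one_lt_card.1 h
    rw [Finset.mem_sdiff] at ha ha'
    let p₁ : Fin n → ℝ := Function.update p a 0
    have hsum : ∀ X, a ∈ X → ∑ i ∈ X, p₁ i = ∑ i ∈ X, p i - p a := by
      intro X hX
      rw [← Finset.add_sum_erase X _ hX, ← Finset.add_sum_erase X p hX]
      have : ∑ i ∈ X.erase a, p₁ i = ∑ i ∈ X.erase a, p i :=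
        Finset.sum_congr rfl fun i hi => by simp [p₁, Finset.ne_of_mem_erase hi]
      rw [this]; simp [p₁]
    obtain ⟨X, hX1, hX2, hXmax, hXS⟩ := hgs.exists_isMax_interval hf
      (p := p₁) (q := p) (I := S ∩ T) (U := S ∪ T) (Y := S)
      (fun i => by
        rcases eq_or_ne i a with rfl | hi
        · simp [p₁]
        · simpa [p₁, hi] using hp i)
      (fun i => by
        rcases eq_or_ne i a with rfl | hi
        · simpa [p₁] using hp i
        · simp [p₁, hi])
      (hIS.trans hSU) hIS hSU (by
        intro X h1 h2
        -- The free item `a` may be added to every set.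
        have e1 : f X - ∑ i ∈ X, p₁ i ≤ f (insert a X) - ∑ i ∈ insert a X, p₁ i := by
          by_cases haX : a ∈ X
          · rw [Finset.insert_eq_of_mem haX]
          · rw [Finset.sum_insert haX]
            have := hf.mono _ _ (Finset.subset_insert a X)
            simp only [p₁, Function.update_self]
            linarith
        have e2 := hother (insert a X) (h1.trans (Finset.subset_insert a X))
          (Finset.insert_subset (hSU ha.1) h2)
          (fun h => ha.2 (h ▸ Finset.mem_insert_self a X))
        rw [hsum _ (Finset.mem_insert_self a X)] at e1
        rw [hsum S ha.1]
        linarith)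
    have hXT : X = T := by
      by_contra hne
      exact absurd ((hXmax T hIT hTU).trans (hother X hX1 hX2 hne)) (not_le.2 hT)
    have := hXS a' ha'.1 (by simp [p₁, haa.symm])
    exact ha'.2 (hXT ▸ this)

end SingleImprovement

/-! ### Critical payments and the local search -/

section LocalSearch

variable {n : ℕ} {f : Finset (Fin n) → ℝ} {c : Fin n → ℝ}

/-- `S` is in the agent's demand when he is paid `α` on success and nothing on failure. -/
def InLinearDemand (f : Finset (Fin n) → ℝ) (c : Fin n → ℝ) (α : ℝ) (S : Finset (Fin n)) : Prop :=
  ∀ S', α * f S' - ∑ i ∈ S', c i ≤ α * f S - ∑ i ∈ S, c i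

/-- The set that results from `S` when `a` is removed and `b` is added.  For `a ∉ S` and for `a = b`
this only adds `b`. -/
def exchange (S : Finset (Fin n)) (a b : Fin n) : Finset (Fin n) := insert b (S.erase a)

/-- The increase in cost from `S` to `exchange S a b`, provided that `b ∉ S`. -/
def exchangeCost (c : Fin n → ℝ) (S : Finset (Fin n)) (a b : Fin n) : ℝ :=
  c b - if a ∈ S then c a else 0

/-- The payment for which the agent is indifferent between `S` and `exchange S a b`, if the latter
is the more successful set. -/
noncomputable def exchangeRatio (f : Finset (Fin n) → ℝ) (c : Fin n → ℝ) (S : Finset (Fin n))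
    (a b : Fin n) : ℝ :=
  exchangeCost c S a b / (f (exchange S a b) - f S)

theorem notMem_of_lt_exchange (hf : IsSuccessProbability f) {S : Finset (Fin n)} {a b : Fin n}
    (h : f S < f (exchange S a b)) : b ∉ S := fun hb =>
  not_le.2 h (hf.mono _ _ (Finset.insert_subset hb (Finset.erase_subset _ _)))

theorem sum_exchange (w : Fin n → ℝ) {S : Finset (Fin n)} {a b : Fin n} (hb : b ∉ S) :
    ∑ i ∈ exchange S a b, w i = ∑ i ∈ S, w i + exchangeCost w S a b := by
  unfold exchange exchangeCost
  rw [Finset.sum_insert (fun h => hb (Finset.mem_of_mem_erase h))]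
  by_cases ha : a ∈ S
  · rw [if_pos ha, ← Finset.add_sum_erase S w ha]; ring
  · rw [if_neg ha, Finset.erase_eq_of_notMem ha]; ring

/-- A more successful set that differs from `S` by at most one addition and one removal arises by
an exchange. -/
theorem exists_eq_exchange (hf : IsSuccessProbability f) {S T : Finset (Fin n)} (hST : f S < f T)
    (h1 : (T \ S).card ≤ 1) (h2 : (S \ T).card ≤ 1) : ∃ a b, T = exchange S a b := by
  have hne : (T \ S).Nonempty := by
    rw [Finset.nonempty_iff_ne_empty, Ne, Finset.sdiff_eq_empty_iff_subset]
    exact fun h => not_le.2 hST (hf.mono _ _ h)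
  obtain ⟨b, hb⟩ := Finset.card_eq_one.1 (le_antisymm h1 hne.card_pos)
  have hb' := Finset.ext_iff.1 hb
  simp only [Finset.mem_sdiff, Finset.mem_singleton] at hb'
  rcases Finset.eq_empty_or_nonempty (S \ T) with h0 | h0
  · refine ⟨b, b, ?_⟩
    rw [Finset.sdiff_eq_empty_iff_subset] at h0
    ext i
    have := hb' i
    have := @h0 i
    have := (hb' b).2 rfl
    simp only [exchange, Finset.mem_insert, Finset.mem_erase]
    grind
  · obtain ⟨a, ha⟩ := Finset.card_eq_one.1 (le_antisymm h2 h0.card_pos)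
    have ha' := Finset.ext_iff.1 ha
    simp only [Finset.mem_sdiff, Finset.mem_singleton] at ha'
    refine ⟨a, b, ?_⟩
    ext i
    have := hb' i
    have := ha' i
    simp only [exchange, Finset.mem_insert, Finset.mem_erase]
    grind

/-- A demanded set stays in demand as the payment rises, up to the first payment that makes the
agent indifferent to an exchange. -/
theorem InLinearDemand.of_le_exchangeRatio (hf : IsSuccessProbability f) (hgs : GrossSubstitutes f)
    (hc : ∀ a, 0 < c a) {S : Finset (Fin n)} {α β : ℝ} (hα : 0 ≤ α) (hαβ : α ≤ β)
    (hS : InLinearDemand f c α S)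
    (hβ : ∀ a b, f S < f (exchange S a b) → β ≤ exchangeRatio f c S a b) :
    InLinearDemand f c β S := by
  rcases hα.trans hαβ |>.eq_or_lt with h0 | hβ0
  · rwa [show β = α by linarith]
  have hdem : InDemandAtPrices f (fun i => c i / β) S := by
    refine hgs.inDemandAtPrices_of_local hf (fun i => (div_pos (hc i) hβ0).le) fun T h1 h2 => ?_
    have key : β * f T - ∑ i ∈ T, c i ≤ β * f S - ∑ i ∈ S, c i := by
      rcases le_or_gt (f T) (f S) with hle | hlt
      · have := hS T
        nlinarith
      · obtain ⟨a, b, rfl⟩ := exists_eq_exchange hf hlt h1 h2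
        have := hβ a b hlt
        rw [exchangeRatio, le_div_iff₀ (sub_pos.2 hlt)] at this
        rw [sum_exchange c (notMem_of_lt_exchange hf hlt)]
        linarith
    rw [← Finset.sum_div, ← Finset.sum_div]
    have e : ∀ X, f X - (∑ i ∈ X, c i) / β = (β * f X - ∑ i ∈ X, c i) / β := fun X => by
      field_simp
    rw [e, e]
    exact div_le_div_of_nonneg_right key hβ0.le
  intro T
  have := hdem T
  rw [← Finset.sum_div, ← Finset.sum_div] at this
  have e : ∀ X, β * f X - ∑ i ∈ X, c i = β * (f X - (∑ i ∈ X, c i) / β) := fun X => by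
    field_simp
  rw [e, e]
  exact mul_le_mul_of_nonneg_left this hβ0.le

theorem InLinearDemand.le_of_lt {S T : Finset (Fin n)} {α β : ℝ} (hαβ : α < β)
    (hS : InLinearDemand f c α S) (hT : InLinearDemand f c β T) : f S ≤ f T := by
  have h1 := hS T
  have h2 := hT S
  nlinarith

theorem inLinearDemand_zero (hc : ∀ a, 0 < c a) {S : Finset (Fin n)} :
    InLinearDemand f c 0 S ↔ S = ∅ := by
  constructor
  · intro h
    have h0 := h ∅
    simp only [zero_mul, Finset.sum_empty, zero_sub, sub_zero] at h0
    by_contra hne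
    have := Finset.sum_pos (fun i (_ : i ∈ S) => hc i) (Finset.nonempty_iff_ne_empty.2 hne)
    linarith
  · rintro rfl T
    have := Finset.sum_nonneg fun i (_ : i ∈ T) => (hc i).le
    simp only [zero_mul, Finset.sum_empty]
    linarith

theorem InLinearDemand.le_exchangeRatio (hf : IsSuccessProbability f) {S : Finset (Fin n)} {α : ℝ}
    (hS : InLinearDemand f c α S) {a b : Fin n} (hlt : f S < f (exchange S a b)) :
    α ≤ exchangeRatio f c S a b := by
  rw [exchangeRatio, le_div_iff₀ (sub_pos.2 hlt)]
  have := hS (exchange S a b)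
  rw [sum_exchange c (notMem_of_lt_exchange hf hlt)] at this
  linarith

theorem InLinearDemand.exchange_of_ratio (hf : IsSuccessProbability f) {S : Finset (Fin n)}
    {a b : Fin n} (hlt : f S < f (exchange S a b)) (hS : InLinearDemand f c (exchangeRatio f c S a b) S) :
    InLinearDemand f c (exchangeRatio f c S a b) (exchange S a b) := by
  intro T
  refine (hS T).trans (le_of_eq ?_)
  rw [sum_exchange c (notMem_of_lt_exchange hf hlt)]
  have : exchangeRatio f c S a b * (f (exchange S a b) - f S) =
      exchangeCost c S a b := div_mul_cancel₀ _ (sub_pos.2 hlt).ne'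
  linarith

/-- The rank of an action in the order of costs. -/
noncomputable def costRank (c : Fin n → ℝ) (a : Fin n) : ℕ :=
  (Finset.univ.filter fun b => c b ≤ c a).card

/-- The sum of the cost ranks of the actions in `S`; the local search increases it. -/
noncomputable def rankSum (c : Fin n → ℝ) (S : Finset (Fin n)) : ℕ := ∑ a ∈ S, costRank c a

theorem rankSum_le (S : Finset (Fin n)) : rankSum c S ≤ n * n := by
  have h1 : rankSum c S ≤ S.card * n :=
    Finset.sum_le_card_nsmul _ _ _ fun a _ => card_finset_fin_le _
  exact h1.trans (Nat.mul_le_mul_right _ (card_finset_fin_le S))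

theorem costRank_pos (a : Fin n) : 0 < costRank c a :=
  Finset.card_pos.2 ⟨a, by simp⟩

theorem costRank_lt {a b : Fin n} (h : c a < c b) : costRank c a < costRank c b := by
  refine Finset.card_lt_card (Finset.ssubset_iff_of_subset ?_ |>.2 ⟨b, ?_, ?_⟩)
  · intro i
    simp only [Finset.mem_filter, Finset.mem_univ, true_and]
    exact fun hi => hi.trans h.le
  · simp
  · simpa using h

theorem rankSum_lt_exchange {S : Finset (Fin n)} {a b : Fin n} (hb : b ∉ S)
    (hcost : 0 < exchangeCost c S a b) : rankSum c S < rankSum c (exchange S a b) := by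
  unfold rankSum exchange
  unfold exchangeCost at hcost
  rw [Finset.sum_insert (fun h => hb (Finset.mem_of_mem_erase h))]
  by_cases ha : a ∈ S
  · rw [if_pos ha] at hcost
    rw [← Finset.add_sum_erase S _ ha]
    have := costRank_lt (sub_pos.1 hcost)
    omega
  · rw [Finset.erase_eq_of_notMem ha]
    have := costRank_pos (c := c) b
    omega

/-- The invariant of the local search.  The set `S` is in demand at the critical payment `α`, the
payment `out` earns the principal at least `best`, and `best` is at least what she obtains from `S`
at `α` and from any payment below `α`. -/
structure SearchInvariant (f : Finset (Fin n) → ℝ) (c : Fin n → ℝ) (S : Finset (Fin n))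
    (α best out : ℝ) : Prop where
  nonneg : 0 ≤ α
  mem_demand : InLinearDemand f c α S
  out_nonneg : 0 ≤ out
  out_le_one : out ≤ 1
  best_nonneg : 0 ≤ best
  exists_le : ∃ X, InLinearDemand f c out X ∧ best ≤ (1 - out) * f X
  current_le : (1 - α) * f S ≤ best
  below_le : ∀ β, 0 ≤ β → β ≤ 1 → β < α → ∀ X, InLinearDemand f c β X → (1 - β) * f X ≤ best

theorem searchInvariant_initial (hf : IsSuccessProbability f) (hc : ∀ a, 0 < c a) :
    SearchInvariant f c ∅ 0 0 0 where
  nonneg := le_rfl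
  mem_demand := (inLinearDemand_zero hc).2 rfl
  out_nonneg := le_rfl
  out_le_one := zero_le_one
  best_nonneg := le_rfl
  exists_le := ⟨∅, (inLinearDemand_zero hc).2 rfl, by simp [hf.empty]⟩
  current_le := by simp [hf.empty]
  below_le β h0 _ h := absurd h (not_lt.2 h0)

/-- Below the payment `r`, at which `S` is still in demand, no payment earns more than the critical
payment `α` or the payments below `α`. -/
theorem SearchInvariant.le_of_lt (hf : IsSuccessProbability f) {S : Finset (Fin n)}
    {α best out r : ℝ} (h : SearchInvariant f c S α best out) (hr : InLinearDemand f c r S)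
    {β : ℝ} (h0 : 0 ≤ β) (h1 : β ≤ 1) (hβ : β < r) {X : Finset (Fin n)}
    (hX : InLinearDemand f c β X) : (1 - β) * f X ≤ best := by
  rcases lt_or_ge β α with hlt | hge
  · exact h.below_le β h0 h1 hlt X hX
  · have e1 := hX.le_of_lt hβ hr
    have e2 := h.current_le
    have := hf.nonneg S
    nlinarith

theorem SearchInvariant.move (hf : IsSuccessProbability f) (hgs : GrossSubstitutes f)
    (hc : ∀ a, 0 < c a) {S : Finset (Fin n)} {α best out : ℝ} (h : SearchInvariant f c S α best out)
    {a b : Fin n} (hlt : f S < f (exchange S a b))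
    (hmin : ∀ a' b', f S < f (exchange S a' b') →
      exchangeRatio f c S a b ≤ exchangeRatio f c S a' b')
    {v : ℝ} (hv : v = (1 - exchangeRatio f c S a b) * f (exchange S a b)) :
    SearchInvariant f c (exchange S a b) (exchangeRatio f c S a b)
        (if best < v then v else best) (if best < v then exchangeRatio f c S a b else out) ∧
      rankSum c S < rankSum c (exchange S a b) := by
  have hαr := h.mem_demand.le_exchangeRatio hf hlt
  have hSr := h.mem_demand.of_le_exchangeRatio hf hgs hc h.nonneg hαr hmin
  have hTr := hSr.exchange_of_ratio hf hlt
  have hr0 : 0 ≤ exchangeRatio f c S a b := h.nonneg.trans hαr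
  have hbest : best ≤ if best < v then v else best := by split_ifs <;> linarith
  have hvbest : v ≤ if best < v then v else best := by split_ifs <;> linarith
  refine ⟨⟨hr0, hTr, ?_, ?_, h.best_nonneg.trans hbest, ?_, hv ▸ hvbest, ?_⟩, ?_⟩
  · split_ifs
    exacts [hr0, h.out_nonneg]
  · split_ifs with hb
    · have h1 := h.best_nonneg.trans_lt hb
      have h2 := hf.nonneg (exchange S a b)
      by_contra h3
      rw [hv] at h1
      nlinarith
    · exact h.out_le_one
  · split_ifs with hb
    exacts [⟨_, hTr, hv.le⟩, h.exists_le]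
  · intro β h0 h1 hβ X hX
    exact (h.le_of_lt hf hSr h0 h1 hβ hX).trans hbest
  · refine rankSum_lt_exchange (notMem_of_lt_exchange hf hlt) ?_
    have hne : exchangeRatio f c S a b ≠ 0 := fun h0 => by
      rw [h0] at hSr hTr
      rw [(inLinearDemand_zero hc).1 hTr, (inLinearDemand_zero hc).1 hSr] at hlt
      exact lt_irrefl _ hlt
    have : exchangeCost c S a b =
        exchangeRatio f c S a b * (f (exchange S a b) - f S) :=
      (div_mul_cancel₀ _ (sub_pos.2 hlt).ne').symm
    rw [this]
    exact mul_pos (lt_of_le_of_ne hr0 hne.symm) (sub_pos.2 hlt)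

/-- No exchange is improving once the sum of the cost ranks has reached its maximum. -/
theorem SearchInvariant.not_lt_exchange (hf : IsSuccessProbability f) (hgs : GrossSubstitutes f)
    (hc : ∀ a, 0 < c a) {S : Finset (Fin n)} {α best out : ℝ} (h : SearchInvariant f c S α best out)
    (hS : n * n ≤ rankSum c S) (a b : Fin n) : ¬ f S < f (exchange S a b) := by
  intro hlt
  obtain ⟨⟨a₀, b₀⟩, h₀, hmin⟩ := Finset.exists_min_image
    (Finset.univ.filter fun x : Fin n × Fin n => f S < f (exchange S x.1 x.2))
    (fun x => exchangeRatio f c S x.1 x.2) ⟨(a, b), by simpa using hlt⟩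
  have := (h.move hf hgs hc (a := a₀) (b := b₀) (by simpa using h₀)
    (fun a' b' h' => hmin (a', b') (by simpa using h')) rfl).2
  have := rankSum_le (c := c) (exchange S a₀ b₀)
  omega

theorem mem_demand_linear {α : ℝ≥0} {S : Finset (Fin n)} :
    S ∈ demand f c (Contract.linear α) ↔ InLinearDemand f c α S := by
  simp [demand, agentUtility, expectedPayment, Contract.linear, InLinearDemand, mul_comm]

theorem principalUtility_linear (α : ℝ≥0) (S : Finset (Fin n)) :
    principalUtility f (Contract.linear α) S = (1 - α) * f S := by
  simp [principalUtility, expectedPayment, Contract.linear]; ring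

/-- A nonnegative bound on the earnings of the linear contracts with `β ∈ [0, 1]` holds for all
contracts: only the difference of the two payments affects the agent's choice, and a contract whose
difference is not in `[0, 1]` earns nothing. -/
theorem principalValue_le_of_linear (hf : IsSuccessProbability f) (hc : ∀ a, 0 < c a) {best : ℝ}
    (h0 : 0 ≤ best)
    (h : ∀ β : ℝ, 0 ≤ β → β ≤ 1 → ∀ X, InLinearDemand f c β X → (1 - β) * f X ≤ best)
    (t : Contract) : principalValue f c t ≤ best := by
  refine Finset.sup'_le _ _ fun X hX => ?_
  have p0 : (0 : ℝ) ≤ t.onFailure := t.onFailure.2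
  set t0 : ℝ := (t.onFailure : ℝ)
  set t1 : ℝ := (t.onSuccess : ℝ)
  have hdem : InLinearDemand f c (t1 - t0) X := by
    intro Y
    have := (Finset.mem_filter.1 hX).2 Y
    simp only [agentUtility, expectedPayment] at this
    linarith
  have hval : principalUtility f t X = (1 - (t1 - t0)) * f X - t0 := by
    simp only [principalUtility, expectedPayment]; ring
  rw [hval]
  have hX0 := hf.nonneg X
  rcases le_or_gt (t1 - t0) 1 with h1 | h1
  · rcases le_or_gt 0 (t1 - t0) with h2 | h2
    · have := h _ h2 h1 X hdem
      linarith
    · -- A contract that punishes success makes the agent choose the empty set.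
      have e1 := hdem ∅
      have e2 : 0 ≤ ∑ i ∈ X, c i := Finset.sum_nonneg fun i _ => (hc i).le
      have hX : X = ∅ := by
        by_contra hne
        have := Finset.sum_pos (fun i (_ : i ∈ X) => hc i) (Finset.nonempty_iff_ne_empty.2 hne)
        simp only [hf.empty, Finset.sum_empty] at e1
        nlinarith
      rw [hX, hf.empty]
      linarith
  · nlinarith

/-- When no exchange improves the success probability, the search has found an optimal contract. -/
theorem SearchInvariant.isOptimalContract (hf : IsSuccessProbability f) (hgs : GrossSubstitutes f)
    (hc : ∀ a, 0 < c a) {S : Finset (Fin n)} {α best out : ℝ} (h : SearchInvariant f c S α best out)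
    (hstuck : ∀ a b, ¬ f S < f (exchange S a b)) :
    ∃ o : ℝ≥0, out = o ∧ o ≤ 1 ∧ IsOptimalContract f c (Contract.linear o) := by
  refine ⟨⟨out, h.out_nonneg⟩, rfl, h.out_le_one, fun t => ?_⟩
  have hle : best ≤ principalValue f c (Contract.linear ⟨out, h.out_nonneg⟩) := by
    obtain ⟨X, hX, hbest⟩ := h.exists_le
    refine hbest.trans ?_
    have hle := Finset.le_sup' (principalUtility f (Contract.linear ⟨out, h.out_nonneg⟩))
      (mem_demand_linear (α := ⟨out, h.out_nonneg⟩) |>.2 hX)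
    exact (principalUtility_linear ⟨out, h.out_nonneg⟩ X).symm.le.trans hle
  refine (principalValue_le_of_linear hf hc h.best_nonneg (fun β h0 h1 X hX => ?_) t).trans hle
  have hr : InLinearDemand f c (max α β + 1) S :=
    h.mem_demand.of_le_exchangeRatio hf hgs hc h.nonneg
      (by have := le_max_left α β; linarith) fun a b hlt => absurd hlt (hstuck a b)
  exact h.le_of_lt hf hr h0 h1 (by have := le_max_right α β; linarith) hX

end LocalSearch

/-! ### Bit lengths -/

section BitLength

/-- `x` is a quotient, not necessarily in lowest terms, of integers of at most `K` binary digits. -/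
def FractionBound (K : ℕ) (x : ℝ) : Prop :=
  ∃ (a : ℤ) (b : ℕ), 0 < b ∧ a.natAbs < 2 ^ K ∧ b < 2 ^ K ∧ x = a / b

/-- Reduction to lowest terms does not increase the numerator or the denominator. -/
theorem FractionBound.hasBitLength {K : ℕ} {x : ℝ} (h : FractionBound K x) : HasBitLength x K := by
  obtain ⟨a, b, hb, ha, hbK, rfl⟩ := h
  have hden : (a / (b : ℤ) : ℚ).den ≤ b := by
    have := Rat.den_dvd a (b : ℤ)
    exact Nat.le_of_dvd hb (by exact_mod_cast this)
  have hnum : (a / (b : ℤ) : ℚ).num.natAbs ≤ a.natAbs := by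
    rcases eq_or_ne a 0 with rfl | ha0
    · simp
    · have hdvd : (a / (b : ℤ) : ℚ).num ∣ a := by
        have := Rat.num_dvd a (b := (b : ℤ)) (by exact_mod_cast hb.ne')
        exact_mod_cast this
      exact Nat.le_of_dvd (Int.natAbs_pos.2 ha0) (Int.natAbs_dvd_natAbs.2 hdvd)
  exact ⟨(a / (b : ℤ) : ℚ), by push_cast; rfl, Nat.size_le.2 (hnum.trans_lt ha),
    Nat.size_le.2 (hden.trans_lt hbK)⟩

theorem HasBitLength.fractionBound {K : ℕ} {x : ℝ} (h : HasBitLength x K) : FractionBound K x := by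
  obtain ⟨q, rfl, h1, h2⟩ := h
  exact ⟨q.num, q.den, q.pos, Nat.size_le.1 h1, Nat.size_le.1 h2, by
    exact_mod_cast (Rat.num_div_den q).symm⟩

theorem FractionBound.mono {K K' : ℕ} (hK : K ≤ K') {x : ℝ} (h : FractionBound K x) :
    FractionBound K' x := by
  obtain ⟨a, b, hb, ha, hbK, rfl⟩ := h
  have : 2 ^ K ≤ 2 ^ K' := Nat.pow_le_pow_right two_pos hK
  exact ⟨a, b, hb, ha.trans_le this, hbK.trans_le this, rfl⟩

theorem fractionBound_intCast {K : ℕ} (hK : 1 ≤ K) {k : ℤ} (hk : k.natAbs ≤ 1) :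
    FractionBound K k := by
  have : 2 ^ 1 ≤ 2 ^ K := Nat.pow_le_pow_right two_pos hK
  exact ⟨k, 1, one_pos, by omega, by omega, by simp⟩

theorem fractionBound_zero {K : ℕ} (hK : 1 ≤ K) : FractionBound K 0 := by
  simpa using fractionBound_intCast hK (k := 0) (by simp)

variable {K : ℕ} {x y : ℝ}

theorem mul_lt_two_pow {a b : ℕ} (ha : a < 2 ^ K) (hb : b < 2 ^ K) :
    a * b < 2 ^ (2 * K) := by
  rw [two_mul, pow_add]
  exact Nat.mul_lt_mul'' ha hb

theorem FractionBound.add (hx : FractionBound K x) (hy : FractionBound K y) :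
    FractionBound (2 * K + 1) (x + y) := by
  obtain ⟨a, b, hb, ha, hbK, rfl⟩ := hx
  obtain ⟨a', b', hb', ha', hbK', rfl⟩ := hy
  refine ⟨a * b' + a' * b, b * b', Nat.mul_pos hb hb', ?_, ?_, ?_⟩
  · have h1 := mul_lt_two_pow ha hbK'
    have h2 := mul_lt_two_pow ha' hbK
    have h3 := Int.natAbs_add_le (a * b') (a' * b)
    rw [Int.natAbs_mul, Int.natAbs_mul, Int.natAbs_natCast, Int.natAbs_natCast] at h3
    rw [pow_succ]; omega
  · have := mul_lt_two_pow hbK hbK'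
    rw [pow_succ]; omega
  · have : (b : ℝ) ≠ 0 := by exact_mod_cast hb.ne'
    have : (b' : ℝ) ≠ 0 := by exact_mod_cast hb'.ne'
    push_cast; field_simp

theorem FractionBound.neg (hx : FractionBound K x) : FractionBound K (-x) := by
  obtain ⟨a, b, hb, ha, hbK, rfl⟩ := hx
  exact ⟨-a, b, hb, by rwa [Int.natAbs_neg], hbK, by push_cast; ring⟩

theorem FractionBound.sub (hx : FractionBound K x) (hy : FractionBound K y) :
    FractionBound (2 * K + 1) (x - y) := by
  rw [sub_eq_add_neg]
  exact hx.add hy.neg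

theorem FractionBound.mul (hx : FractionBound K x) (hy : FractionBound K y) :
    FractionBound (2 * K + 1) (x * y) := by
  obtain ⟨a, b, hb, ha, hbK, rfl⟩ := hx
  obtain ⟨a', b', hb', ha', hbK', rfl⟩ := hy
  refine ⟨a * a', b * b', Nat.mul_pos hb hb', ?_, ?_, ?_⟩
  · have := mul_lt_two_pow ha ha'
    rw [Int.natAbs_mul, pow_succ]; omega
  · have := mul_lt_two_pow hbK hbK'
    rw [pow_succ]; omega
  · push_cast; exact div_mul_div_comm _ _ _ _

theorem FractionBound.inv (hK : 1 ≤ K) (hx : FractionBound K x) : FractionBound K x⁻¹ := by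
  obtain ⟨a, b, hb, ha, hbK, rfl⟩ := hx
  rcases lt_trichotomy a 0 with h | h | h
  · refine ⟨-b, a.natAbs, by omega, by simpa using hbK, ha, ?_⟩
    have : ((a.natAbs : ℤ) : ℝ) = ((-a : ℤ) : ℝ) := by congr 1; omega
    rw [Int.cast_natCast] at this
    rw [this]; push_cast; rw [inv_div, neg_div_neg_eq]
  · subst h
    simpa using fractionBound_zero hK
  · refine ⟨b, a.natAbs, by omega, by simpa using hbK, ha, ?_⟩
    have : ((a.natAbs : ℤ) : ℝ) = (a : ℝ) := by congr 1; omega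
    rw [Int.cast_natCast] at this
    rw [this]; push_cast; rw [inv_div]

theorem FractionBound.div (hK : 1 ≤ K) (hx : FractionBound K x) (hy : FractionBound K y) :
    FractionBound (2 * K + 1) (x / y) := by
  rw [div_eq_mul_inv]
  exact hx.mul (hy.inv hK)

end BitLength

section Levels

/-- The bound on the digits of a number of level `l`, when numbers of level `0` have at most `K`
digits: one arithmetic operation leads to the next level. -/
def levelBound (K : ℕ) : ℕ → ℕ
  | 0 => K
  | l + 1 => 2 * levelBound K l + 1

theorem levelBound_mono (K : ℕ) : Monotone (levelBound K) :=
  monotone_nat_of_le_succ fun l => by simp only [levelBound]; omega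

theorem one_le_levelBound {K : ℕ} (hK : 1 ≤ K) (l : ℕ) : 1 ≤ levelBound K l :=
  hK.trans (levelBound_mono K (Nat.zero_le l))

/-- When real array `r` is assigned the level `lev r`, arithmetic operations lead to higher levels,
and copies do not lead to lower ones. -/
def Instruction.Levelled (lev : ℕ → ℕ) : Instruction → Prop
  | .realConst _ k => k.natAbs ≤ 1
  | .realCopy d u => lev u.array ≤ lev d.array
  | .realAdd d u v | .realSub d u v | .realMul d u v | .realDiv d u v =>
    lev u.array < lev d.array ∧ lev v.array < lev d.array
  | _ => True

/-- All instructions of the program respect the levels `lev` of the real arrays. -/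
def Program.Levelled (lev : ℕ → ℕ) : Program → Prop
  | .skip => True
  | .basic i => i.Levelled lev
  | .seq P Q => P.Levelled lev ∧ Q.Levelled lev
  | .ite _ P Q => P.Levelled lev ∧ Q.Levelled lev
  | .loop _ P => P.Levelled lev

/-- All numbers in the real arrays obey the bounds of their levels. -/
def Memory.Bounded (lev : ℕ → ℕ) (K : ℕ) (m : Memory) : Prop :=
  ∀ r i, FractionBound (levelBound K (lev r)) (m.real r i)

variable {n : ℕ} {f : Finset (Fin n) → ℝ} {lev : ℕ → ℕ} {K : ℕ}

theorem Memory.Bounded.set {m : Memory} (hm : m.Bounded lev K) (d : Cell) {v : ℝ}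
    (hv : FractionBound (levelBound K (lev d.array)) v) : (m.set d v).Bounded lev K := by
  intro r i
  simp only [Memory.set]
  rcases eq_or_ne r d.array with rfl | hr
  · rw [Function.update_self]
    rcases eq_or_ne i (m.reg d.index) with rfl | hi
    · rwa [Function.update_self]
    · rw [Function.update_of_ne hi]; exact hm _ _
  · rw [Function.update_of_ne hr]; exact hm _ _

theorem Memory.Bounded.get_lt {m : Memory} (hm : m.Bounded lev K) {u : Cell} {l : ℕ}
    (h : lev u.array < l + 1) : FractionBound (levelBound K l) (m.get u) :=
  (hm _ _).mono (levelBound_mono K (Nat.lt_succ_iff.1 h))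

theorem Memory.Bounded.exec (hK : 1 ≤ K) (hf : ∀ S, FractionBound K (f S)) {m : Memory}
    (hm : m.Bounded lev K) {i : Instruction} (hi : i.Levelled lev) :
    (i.exec f m).Bounded lev K := by
  have op : ∀ {d u v : Cell} {g : ℝ → ℝ → ℝ},
      (∀ k x y, 1 ≤ k → FractionBound k x → FractionBound k y → FractionBound (2 * k + 1) (g x y)) →
      lev u.array < lev d.array ∧ lev v.array < lev d.array →
      (m.set d (g (m.get u) (m.get v))).Bounded lev K := by
    intro d u v g hg h
    obtain ⟨l, hl⟩ : ∃ l, lev d.array = l + 1 := Nat.exists_eq_succ_of_ne_zero (by omega)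
    rw [hl] at h
    refine hm.set d ?_
    rw [hl]
    exact hg _ _ _ (one_le_levelBound hK l) (hm.get_lt h.1) (hm.get_lt h.2)
  cases i with
  | const | add | sub | load | store => exact hm
  | realConst d k => exact hm.set d (fractionBound_intCast (one_le_levelBound hK _) hi)
  | realCopy d u => exact hm.set d ((hm _ _).mono (levelBound_mono K hi))
  | realAdd d u v => exact op (g := (· + ·)) (fun _ _ _ _ h h' => h.add h') hi
  | realSub d u v => exact op (g := (· - ·)) (fun _ _ _ _ h h' => h.sub h') hi
  | realMul d u v => exact op (g := (· * ·)) (fun _ _ _ _ h h' => h.mul h') hi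
  | realDiv d u v => exact op (g := (· / ·)) (fun _ _ _ hk h h' => h.div hk h') hi
  | query d a => exact hm.set d ((hf _).mono (levelBound_mono K (Nat.zero_le _)))

theorem Config.step_levelled (hK : 1 ≤ K) (hf : ∀ S, FractionBound K (f S)) {C : Config}
    (h : (∀ P ∈ C.todo, P.Levelled lev) ∧ C.mem.Bounded lev K) :
    (∀ P ∈ (C.step f).todo, P.Levelled lev) ∧ (C.step f).mem.Bounded lev K := by
  obtain ⟨todo, m⟩ := C
  obtain ⟨ht, hm⟩ := h
  dsimp only at ht hm
  rcases todo with _ | ⟨P, k⟩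
  · exact ⟨ht, hm⟩
  have hP := ht P List.mem_cons_self
  have hk : ∀ Q ∈ k, Q.Levelled lev := fun Q hQ => ht Q (List.mem_cons_of_mem _ hQ)
  cases P with
  | skip => exact ⟨hk, hm⟩
  | basic i => exact ⟨hk, hm.exec hK hf hP⟩
  | seq P Q => exact ⟨by simpa [Config.step] using ⟨hP.1, hP.2, hk⟩, hm⟩
  | ite b P Q =>
    simp only [Config.step]
    split_ifs
    exacts [⟨by simpa using ⟨hP.1, hk⟩, hm⟩, ⟨by simpa using ⟨hP.2, hk⟩, hm⟩]
  | loop b P =>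
    simp only [Config.step]
    split_ifs
    exacts [⟨by simpa using ⟨hP, ⟨hP, hk⟩⟩, hm⟩, ⟨hk, hm⟩]

/-- All numbers that occur in a run of a levelled program are bounded. -/
theorem Program.Levelled.fractionBound_run {P : Program} (hP : P.Levelled lev) (hK : 1 ≤ K)
    (hf : ∀ S, FractionBound K (f S)) {c : Fin n → ℝ} (hc : ∀ a, FractionBound K (c a))
    (T r i : ℕ) :
    FractionBound (levelBound K (lev r)) ((P.run f c T).mem.real r i) := by
  have key : (∀ Q ∈ (P.run f c T).todo, Q.Levelled lev) ∧ (P.run f c T).mem.Bounded lev K := by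
    induction T with
    | zero =>
      refine ⟨by simpa [Program.run] using hP, fun r i => ?_⟩
      simp only [Program.run, Function.iterate_zero, id_eq, Memory.initial]
      split_ifs
      exacts [(hc _).mono (levelBound_mono K (Nat.zero_le _)),
        fractionBound_zero (one_le_levelBound hK _)]
    | succ T ih =>
      rw [Program.run, Function.iterate_succ_apply']
      exact Config.step_levelled hK hf ih
  exact key.2 r i

end Levels

/-! ### Total correctness with time bounds -/

section Hoare

variable {n : ℕ}

/-- From `m`, the program `P` ends in `m'` after exactly `s` steps. -/
def Program.Runs (f : Finset (Fin n) → ℝ) (P : Program) (m m' : Memory) (s : ℕ) : Prop :=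
  ∀ k, (Config.step f)^[s] ⟨P :: k, m⟩ = ⟨k, m'⟩

/-- From every memory with `A`, the program `P` halts within `t` steps in a memory with `B`. -/
def Program.Triple (f : Finset (Fin n) → ℝ) (A : Memory → Prop) (P : Program) (t : ℕ)
    (B : Memory → Prop) : Prop :=
  ∀ m, A m → ∃ s ≤ t, ∃ m', P.Runs f m m' s ∧ B m'

variable {f : Finset (Fin n) → ℝ} {A B C : Memory → Prop} {P Q : Program} {s t : ℕ}

theorem Program.Triple.skip : Program.skip.Triple f A 1 A :=
  fun m h => ⟨1, le_rfl, m, fun _ => rfl, h⟩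

theorem Program.Triple.basic {i : Instruction} (h : ∀ m, A m → B (i.exec f m)) :
    (Program.basic i).Triple f A 1 B :=
  fun m hm => ⟨1, le_rfl, _, fun _ => rfl, h m hm⟩

theorem Program.Triple.imp {A' B' : Memory → Prop} (h : P.Triple f A s B) (hA : ∀ m, A' m → A m)
    (hB : ∀ m, B m → B' m) (hst : s ≤ t) : P.Triple f A' t B' := by
  intro m hm
  obtain ⟨r, hr, m', hrun, hb⟩ := h m (hA m hm)
  exact ⟨r, hr.trans hst, m', hrun, hB _ hb⟩

theorem Program.Triple.seq (hP : P.Triple f A s B) (hQ : Q.Triple f B t C) :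
    (Program.seq P Q).Triple f A (s + t + 1) C := by
  intro m hm
  obtain ⟨s', hs, m', h1, hm'⟩ := hP m hm
  obtain ⟨t', ht, m'', h2, hm''⟩ := hQ m' hm'
  refine ⟨t' + (s' + 1), by omega, m'', fun k => ?_, hm''⟩
  rw [Function.iterate_add_apply, Function.iterate_add_apply]
  exact (congrArg _ (h1 (Q :: k))).trans (h2 k)

theorem Program.Triple.ite {b : Test} (hP : P.Triple f (fun m => A m ∧ b.Holds m) t B)
    (hQ : Q.Triple f (fun m => A m ∧ ¬ b.Holds m) t B) :
    (Program.ite b P Q).Triple f A (t + 1) B := by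
  intro m hm
  by_cases hb : b.Holds m
  · obtain ⟨s, hs, m', h, hm'⟩ := hP m ⟨hm, hb⟩
    refine ⟨s + 1, by omega, m', fun k => ?_, hm'⟩
    rw [Function.iterate_succ_apply]
    simpa [Config.step, hb] using h k
  · obtain ⟨s, hs, m', h, hm'⟩ := hQ m ⟨hm, hb⟩
    refine ⟨s + 1, by omega, m', fun k => ?_, hm'⟩
    rw [Function.iterate_succ_apply]
    simpa [Config.step, hb] using h k

/-- A loop that raises the counter `x` by one in every round, while it is below `reg 0`.  The
invariant `I i` describes the memory when the counter is `i`. -/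
theorem Program.Triple.loop {x : ℕ} {I : ℕ → Memory → Prop} {N : ℕ}
    (hI : ∀ i m, I i m → m.reg x = i ∧ m.reg 0 = N)
    (hP : ∀ i < N, P.Triple f (I i) t (I (i + 1))) :
    (Program.loop (.lt x 0) P).Triple f (I 0) (N * (t + 1) + 1) (I N) := by
  suffices h : ∀ j i, i + j = N →
      (Program.loop (.lt x 0) P).Triple f (I i) (j * (t + 1) + 1) (I N) from
    h N 0 (Nat.zero_add N)
  intro j
  induction j with
  | zero =>
    rintro i rfl m hm
    refine ⟨1, by omega, m, fun k => ?_, hm⟩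
    have := hI _ _ hm
    have hb : ¬ (Test.lt x 0).Holds m := by simp only [Test.Holds]; omega
    simp [Config.step, hb]
  | succ j ih =>
    intro i hij m hm
    have := hI _ _ hm
    have hb : (Test.lt x 0).Holds m := by simp only [Test.Holds]; omega
    obtain ⟨s, hs, m', h1, hm'⟩ := hP i (by omega) m hm
    obtain ⟨s', hs', m'', h2, hm''⟩ := ih (i + 1) (by omega) m' hm'
    refine ⟨s' + (s + 1), by rw [Nat.succ_mul]; omega, m'', fun k => ?_, hm''⟩
    have h0 : Config.step f ⟨.loop (.lt x 0) P :: k, m⟩ = ⟨P :: .loop (.lt x 0) P :: k, m⟩ := by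
      simp [Config.step, hb]
    rw [Function.iterate_add_apply, Function.iterate_succ_apply, h0, h1, h2]

/-- The straight-line program that executes the instructions of a list. -/
def block : List Instruction → Program
  | [] => .skip
  | i :: l => .seq (.basic i) (block l)

theorem Program.Triple.block {l : List Instruction}
    (h : ∀ m, A m → B (l.foldl (fun m i => i.exec f m) m)) :
    (CombinatorialContracts.block l).Triple f A (2 * l.length + 1) B := by
  induction l generalizing A with
  | nil => exact Program.Triple.skip.imp h (fun _ h => h) le_rfl
  | cons i l ih =>
    refine Program.Triple.imp (Program.Triple.seq
      (Program.Triple.basic (B := fun m => B (l.foldl (fun m i => i.exec f m) m)) h)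
      (ih fun m hm => hm)) (fun _ h => h) (fun _ h => h) ?_
    simp only [List.length_cons]; omega

theorem block_levelled {lev : ℕ → ℕ} {l : List Instruction} :
    (block l).Levelled lev ↔ ∀ i ∈ l, i.Levelled lev := by
  induction l with
  | nil => simp [CombinatorialContracts.block, Program.Levelled]
  | cons i l ih => simp [CombinatorialContracts.block, Program.Levelled, ih]

end Hoare

/-! ### The program -/

section Code

/-- The cell at position `0` of real array `r`; register `2` always holds `0`. -/
def scalar (r : ℕ) : Cell := ⟨r, 2⟩

/-- `for x = 0, …, reg 0 - 1`; register `1` holds `1`. -/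
def forLoop (x : ℕ) (P : Program) : Program :=
  .seq (.basic (.const x 0)) (.loop (.lt x 0) (.seq P (.basic (.add x x 1))))

/-- Computes, for `a = reg 5` and `b = reg 6`, the value of `exchange S a b` and its ratio.  Integer
array `0`, which holds `S`, is changed for the query and then restored. -/
def evalExchange : Program :=
  block [.load 10 0 5, .load 11 0 6, .store 0 5 2, .store 0 6 1, .query (scalar 4) 0,
    .store 0 6 11, .store 0 5 10,
    .realSub (scalar 5) ⟨0, 6⟩ ⟨2, 5⟩, .realSub (scalar 6) (scalar 4) (scalar 3),
    .realDiv (scalar 7) (scalar 5) (scalar 6)]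

/-- Records the exchange under inspection as the best one so far. -/
def recordExchange : Program :=
  block [.realCopy (scalar 8) (scalar 7), .const 7 1, .add 8 5 2, .add 9 6 2]

/-- Evaluates an exchange, and records it if it is improving and its ratio is the least so far. -/
def inspect : Program :=
  .seq evalExchange
    (.ite (.realLt (scalar 3) (scalar 4))
      (.ite (.lt 2 7) (.ite (.realLt (scalar 7) (scalar 8)) recordExchange .skip) recordExchange)
      .skip)

/-- Carries out the recorded exchange and computes what the principal earns at its ratio. -/
def applyExchange : Program :=
  block [.store 0 8 2, .store 0 9 1, .realConst ⟨2, 8⟩ 0, .realCopy ⟨2, 9⟩ ⟨0, 9⟩,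
    .query (scalar 4) 0, .realSub (scalar 10) (scalar 9) (scalar 8),
    .realMul (scalar 11) (scalar 10) (scalar 4)]

/-- One round of the local search: the improving exchange of least ratio is carried out, and the
best payment is updated. -/
def searchRound : Program :=
  .seq (block [.query (scalar 3) 0, .const 7 0])
    (.seq (forLoop 5 (forLoop 6 inspect))
      (.ite (.lt 2 7)
        (.seq applyExchange
          (.ite (.realLt (scalar 12) (scalar 11))
            (block [.realCopy (scalar 12) (scalar 11), .realCopy (scalar 1) (scalar 8)]) .skip))
        .skip))

/-- The whole search: `n * n` rounds.

Registers: `0` holds `n`, `1` holds `1`, `2` holds `0`, `3` and `4` count the rounds, `5` and `6`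
are the actions of the exchange under inspection, `7` tells whether an exchange is recorded, `8` and
`9` are its actions, `10` and `11` are auxiliary.  Integer array `0` is the current set `S`.
Real arrays: `0` holds the costs, `2` the costs of the actions in `S` (and `0` elsewhere).  The
others are used at position `0` only: `1` is the best payment, `3` the value of `S`, `4` the value
of an exchange, `5`, `6`, `7` its cost difference, value difference and ratio, `8` the ratio of the
recorded exchange, `9` the number `1`, `10` and `11` the principal's share and earnings, `12` her
best earnings. -/
def searchProgram : Program :=
  .seq (block [.const 1 1, .realConst (scalar 9) 1]) (forLoop 3 (forLoop 4 searchRound))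

/-- The levels of the real arrays: the depth of the arithmetic that leads to their contents. -/
def searchLevel : ℕ → ℕ
  | 5 | 6 => 1
  | 1 | 7 | 8 => 2
  | 10 => 3
  | 11 | 12 => 4
  | _ => 0

theorem searchLevel_le (r : ℕ) : searchLevel r ≤ 4 := by
  unfold searchLevel
  split <;> omega

/-- In particular, the program contains no accumulating real arithmetic. -/
theorem searchProgram_levelled : searchProgram.Levelled searchLevel := by
  simp [searchProgram, forLoop, searchRound, inspect, evalExchange, recordExchange, applyExchange,
    Program.Levelled, block_levelled, Instruction.Levelled, scalar, searchLevel]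

end Code

/-! ### Correctness of the program -/

section Correctness

variable {n : ℕ} {f : Finset (Fin n) → ℝ} {c : Fin n → ℝ}

/-- The invariant `J` may not depend on the counter `x`, which the loop itself maintains. -/
theorem Program.Triple.forLoop {x : ℕ} {A B : Memory → Prop} {J : ℕ → Memory → Prop} {N t : ℕ}
    {P : Program} (hstab : ∀ i m v, J i m → J i (m.setReg x v))
    (hJ : ∀ i m, J i m → m.reg 0 = N ∧ m.reg 1 = 1)
    (hP : ∀ i < N, P.Triple f (fun m => J i m ∧ m.reg x = i) t
      (fun m => J (i + 1) m ∧ m.reg x = i))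
    (hA : ∀ m, A m → J 0 m) (hB : ∀ m, J N m → B m) :
    (forLoop x P).Triple f A (N * (t + 3) + 3) B := by
  have hloop := Program.Triple.loop (f := f) (x := x) (I := fun i m => J i m ∧ m.reg x = i)
    (fun i m h => ⟨h.2, (hJ i m h.1).1⟩) (fun i hi => (hP i hi).seq
      (Program.Triple.basic (i := .add x x 1) (B := fun m => J (i + 1) m ∧ m.reg x = i + 1)
        fun m h => ⟨hstab _ _ _ h.1, by
          simp [Instruction.exec, Memory.setReg, (hJ _ _ h.1).2, h.2]⟩))
  refine Program.Triple.imp (Program.Triple.seq (Program.Triple.basic (i := .const x 0)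
    (A := A) fun m h => ⟨hstab _ _ _ (hA m h), by simp [Instruction.exec, Memory.setReg]⟩) hloop)
    (fun _ h => h) (fun m h => hB m h.1) ?_
  have : N * (t + 1 + 1 + 1) = N * (t + 3) := rfl
  omega

/-- The memory represents the set `S`, together with the best earnings and the best payment, and the
counters of the rounds are `k₁` and `k₂`. -/
structure Represents (c : Fin n → ℝ) (S : Finset (Fin n)) (best out : ℝ) (k₁ k₂ : ℕ)
    (m : Memory) : Prop where
  size : m.reg 0 = n
  one : m.reg 1 = 1
  zero : m.reg 2 = 0
  count₁ : m.reg 3 = k₁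
  count₂ : m.reg 4 = k₂
  set : m.actionSet n 0 = S
  cost : ∀ i : Fin n, m.real 0 i = c i
  owned : ∀ i : Fin n, m.real 2 i = if i ∈ S then c i else 0
  unit : m.real 9 0 = 1
  best : m.real 12 0 = best
  out : m.real 1 0 = out

/-- The recorded exchange is the improving exchange of least ratio among those in `D`; if none is
recorded, then no exchange in `D` is improving. -/
def Recorded (f : Finset (Fin n) → ℝ) (c : Fin n → ℝ) (S : Finset (Fin n))
    (D : Fin n → Fin n → Prop) (m : Memory) : Prop :=
  (m.reg 7 = 0 ∧ ∀ a b, D a b → ¬ f S < f (exchange S a b)) ∨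
  (m.reg 7 = 1 ∧ ∃ a b : Fin n, m.reg 8 = a ∧ m.reg 9 = b ∧ f S < f (exchange S a b) ∧
    m.real 8 0 = exchangeRatio f c S a b ∧ ∀ a' b', D a' b' → f S < f (exchange S a' b') →
      exchangeRatio f c S a b ≤ exchangeRatio f c S a' b')

/-- The memory while the exchanges of `S` are inspected, those in `D` being done. -/
structure Scanning (f : Finset (Fin n) → ℝ) (c : Fin n → ℝ) (S : Finset (Fin n)) (best out : ℝ)
    (k₁ k₂ : ℕ) (D : Fin n → Fin n → Prop) (m : Memory) : Prop where
  represents : Represents c S best out k₁ k₂ m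
  value : m.real 3 0 = f S
  recorded : Recorded f c S D m

variable {S : Finset (Fin n)} {best out : ℝ} {k₁ k₂ : ℕ} {D : Fin n → Fin n → Prop}

theorem Represents.setReg {m : Memory} (h : Represents c S best out k₁ k₂ m) {x : ℕ} (hx : 4 < x)
    (v : ℕ) : Represents c S best out k₁ k₂ (m.setReg x v) where
  size := (Function.update_of_ne (by omega) _ _).trans h.size
  one := (Function.update_of_ne (by omega) _ _).trans h.one
  zero := (Function.update_of_ne (by omega) _ _).trans h.zero
  count₁ := (Function.update_of_ne (by omega) _ _).trans h.count₁
  count₂ := (Function.update_of_ne (by omega) _ _).trans h.count₂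
  set := h.set
  cost := h.cost
  owned := h.owned
  unit := h.unit
  best := h.best
  out := h.out

theorem Scanning.setReg {m : Memory} (h : Scanning f c S best out k₁ k₂ D m) {x : ℕ}
    (hx : x = 5 ∨ x = 6) (v : ℕ) : Scanning f c S best out k₁ k₂ D (m.setReg x v) where
  represents := h.represents.setReg (by omega) v
  value := h.value
  recorded := by
    have := h.recorded
    rcases hx with rfl | rfl <;> simpa [Recorded, Memory.setReg] using this

theorem Scanning.congr {D' : Fin n → Fin n → Prop} {m : Memory}
    (h : Scanning f c S best out k₁ k₂ D m) (hD : ∀ a b, D' a b ↔ D a b) :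
    Scanning f c S best out k₁ k₂ D' m := by
  have : D' = D := by funext a b; exact propext (hD a b)
  rwa [this]

/-- Restoring the old values in reverse order undoes two updates, even at equal positions. -/
theorem update_update_restore (g : ℕ → ℕ) (a b u : ℕ) :
    Function.update (Function.update (Function.update g a u) b (g b)) a (g a) = g := by
  funext i
  simp only [Function.update_apply]
  split_ifs with h1 h2
  exacts [h1 ▸ rfl, h2 ▸ rfl, rfl]

/-- Writing the indicator of `exchange S a b` over that of `S`. -/
theorem actionSet_exchange {m m' : Memory} (hS : m.actionSet n 0 = S) (a b : Fin n)
    (hm' : m'.arr 0 = Function.update (Function.update (m.arr 0) a 0) b 1) :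
    m'.actionSet n 0 = exchange S a b := by
  ext i
  have hi := Finset.ext_iff.1 hS i
  simp only [Memory.actionSet, Finset.mem_filter, Finset.mem_univ, true_and] at hi
  simp only [Memory.actionSet, Finset.mem_filter, Finset.mem_univ, true_and, hm', exchange,
    Finset.mem_insert, Finset.mem_erase, Function.update_apply, Fin.val_inj]
  by_cases h1 : i = b
  · simp [h1]
  · by_cases h2 : i = a
    · simp [h2]
    · simp [h1, h2, hi]

/-- The memory after `evalExchange`, when `a` and `b` are the actions under inspection. -/
structure Evaluated (f : Finset (Fin n) → ℝ) (c : Fin n → ℝ) (S : Finset (Fin n)) (best out : ℝ)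
    (k₁ k₂ : ℕ) (D : Fin n → Fin n → Prop) (a b : Fin n) (m : Memory) : Prop where
  scanning : Scanning f c S best out k₁ k₂ D m
  fst : m.reg 5 = a
  snd : m.reg 6 = b
  newValue : m.real 4 0 = f (exchange S a b)
  ratio : m.real 7 0 = exchangeRatio f c S a b

theorem evalExchange_triple (a b : Fin n) :
    evalExchange.Triple f
      (fun m => Scanning f c S best out k₁ k₂ D m ∧ m.reg 5 = a ∧ m.reg 6 = b) 21
      (Evaluated f c S best out k₁ k₂ D a b) := by
  refine Program.Triple.block fun m ⟨⟨hr, hv, hrec⟩, ha, hb⟩ => ?_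
  have hrestore := update_update_restore (m.arr 0) a b 0
  have hquery := actionSet_exchange hr.set a b
    (m' := (m.setArr 0 a 0).setArr 0 b 1) (by simp [Memory.setArr])
  have hset := hr.set
  obtain ⟨h1, h2, h3, h4, h5, h6, h7, h8, h9, h10, h11⟩ := hr
  simp only [Memory.actionSet, Memory.setArr, Function.update_self, Function.update_idem, ne_eq]
    at hquery hset
  refine ⟨⟨⟨?_, ?_, ?_, ?_, ?_, ?_, ?_, ?_, ?_, ?_, ?_⟩, ?_, ?_⟩, ?_, ?_, ?_, ?_⟩
  all_goals
    simp [Memory.setReg, Memory.setArr, Memory.set, Memory.get, Instruction.exec, scalar,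
      Memory.actionSet, ha, hb, h1, h2, h3, h4, h5, h7, h8, h9, h10, h11, hv, hrestore, hquery,
      hset, exchangeRatio, exchangeCost]
  simpa [Recorded] using hrec

theorem recordExchange_triple (a b : Fin n) :
    recordExchange.Triple f
      (fun m => Evaluated f c S best out k₁ k₂ D a b m ∧ f S < f (exchange S a b) ∧
        ∀ a' b', D a' b' → f S < f (exchange S a' b') →
          exchangeRatio f c S a b ≤ exchangeRatio f c S a' b') 9
      (fun m => Scanning f c S best out k₁ k₂ (fun a' b' => D a' b' ∨ (a' = a ∧ b' = b)) m ∧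
        m.reg 5 = a ∧ m.reg 6 = b) := by
  refine Program.Triple.block fun m ⟨⟨⟨hr, hv, hrec⟩, ha, hb, hnew, hratio⟩, hlt, hmin⟩ => ?_
  obtain ⟨h1, h2, h3, h4, h5, h6, h7, h8, h9, h10, h11⟩ := hr
  refine ⟨⟨⟨?_, ?_, ?_, ?_, ?_, h6, ?_, ?_, ?_, ?_, ?_⟩, ?_, Or.inr ⟨?_, a, b, ?_, ?_, hlt, ?_, ?_⟩⟩,
    ?_, ?_⟩
  case refine_16 =>
    rintro a' b' (h | ⟨rfl, rfl⟩) hlt'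
    exacts [hmin a' b' h hlt', le_rfl]
  all_goals
    simp [Memory.setReg, Memory.set, Memory.get, Instruction.exec, scalar,
      ha, hb, h1, h2, h3, h4, h5, h7, h8, h9, h10, h11, hv, hratio]


theorem inspect_triple (a b : Fin n) :
    inspect.Triple f
      (fun m => Scanning f c S best out k₁ k₂ D m ∧ m.reg 5 = a ∧ m.reg 6 = b) 34
      (fun m => Scanning f c S best out k₁ k₂ (fun a' b' => D a' b' ∨ (a' = a ∧ b' = b)) m ∧
        m.reg 5 = a ∧ m.reg 6 = b) := by
  refine (evalExchange_triple a b).seq (Program.Triple.ite (t := 11)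
    (Program.Triple.ite (t := 10) (Program.Triple.ite (t := 9) ?_ ?_) ?_) ?_)
  · rintro m ⟨⟨⟨he, hlt⟩, hfound⟩, hratio⟩
    simp only [Test.Holds, Memory.get, scalar, he.scanning.represents.zero, he.scanning.value,
      he.newValue, he.ratio] at hlt hfound hratio
    refine recordExchange_triple a b m ⟨he, hlt, fun a' b' hD hlt' => ?_⟩
    rcases he.scanning.recorded with h | ⟨-, a₀, b₀, -, -, -, h₀, hmin⟩
    · exact absurd h.1 hfound.ne'
    · rw [h₀] at hratio
      exact hratio.le.trans (hmin a' b' hD hlt')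
  · -- The recorded exchange has a ratio that is at most the new one.
    refine Program.Triple.skip.imp (A := fun m => _) (fun m h => h) ?_ (by omega)
    rintro m ⟨⟨⟨he, hlt⟩, hfound⟩, hratio⟩
    simp only [Test.Holds, Memory.get, scalar, he.scanning.represents.zero, he.ratio, not_lt]
      at hfound hratio
    refine ⟨⟨he.scanning.represents, he.scanning.value, ?_⟩, he.fst, he.snd⟩
    rcases he.scanning.recorded with h | ⟨h7, a₀, b₀, h8, h9, hlt₀, h₀, hmin⟩
    · exact absurd h.1 hfound.ne'
    · refine Or.inr ⟨h7, a₀, b₀, h8, h9, hlt₀, h₀, ?_⟩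
      rintro a' b' (h | ⟨rfl, rfl⟩) hlt'
      exacts [hmin a' b' h hlt', h₀ ▸ hratio]
  · refine (recordExchange_triple a b).imp ?_ (fun _ h => h) (by omega)
    rintro m ⟨⟨he, hlt⟩, hfound⟩
    simp only [Test.Holds, Memory.get, scalar, he.scanning.represents.zero, he.scanning.value,
      he.newValue] at hlt hfound
    refine ⟨he, hlt, fun a' b' hD hlt' => ?_⟩
    rcases he.scanning.recorded with h | h
    · exact absurd hlt' (h.2 a' b' hD)
    · omega
  · -- An exchange that is not improving does not affect the record.
    refine Program.Triple.skip.imp (A := fun m => _) (fun m h => h) ?_ (by omega)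
    rintro m ⟨he, hlt⟩
    simp only [Test.Holds, Memory.get, scalar, he.scanning.represents.zero, he.scanning.value,
      he.newValue] at hlt
    refine ⟨⟨he.scanning.represents, he.scanning.value, ?_⟩, he.fst, he.snd⟩
    rcases he.scanning.recorded with ⟨h7, h⟩ | ⟨h7, a₀, b₀, h8, h9, hlt₀, h₀, hmin⟩
    · refine Or.inl ⟨h7, ?_⟩
      rintro a' b' (hD | ⟨rfl, rfl⟩)
      exacts [h a' b' hD, hlt]
    · refine Or.inr ⟨h7, a₀, b₀, h8, h9, hlt₀, h₀, ?_⟩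
      rintro a' b' (hD | ⟨rfl, rfl⟩) hlt'
      exacts [hmin a' b' hD hlt', absurd hlt' hlt]

theorem scan_triple :
    (forLoop 5 (forLoop 6 inspect)).Triple f
      (Scanning f c S best out k₁ k₂ fun _ _ => False) (n * (n * 37 + 6) + 3)
      (Scanning f c S best out k₁ k₂ fun _ _ => True) := by
  refine Program.Triple.forLoop (N := n)
    (J := fun i => Scanning f c S best out k₁ k₂ fun a _ => a < i)
    (fun i m v h => h.setReg (Or.inl rfl) v) (fun i m h => ⟨h.represents.size, h.represents.one⟩)
    (fun i hi => ?_) (fun m h => h.congr (by simp)) (fun m h => h.congr (by simp))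
  refine Program.Triple.forLoop (N := n)
    (J := fun j m => Scanning f c S best out k₁ k₂ (fun a b => a < i ∨ (a = i ∧ b < j)) m ∧
      m.reg 5 = i)
    (fun j m v h => ⟨h.1.setReg (Or.inr rfl) v, by simpa [Memory.setReg] using h.2⟩)
    (fun j m h => ⟨h.1.represents.size, h.1.represents.one⟩) (fun j hj => ?_)
    (fun m h => ⟨h.1.congr (by simp), h.2⟩)
    (fun m h => ⟨h.1.congr fun a b => by have := b.2; omega, h.2⟩)
  exact (inspect_triple ⟨i, hi⟩ ⟨j, hj⟩).imp (fun m h => ⟨h.1.1, h.1.2, h.2⟩)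
    (fun m h => ⟨⟨h.1.congr fun a b => by simp only [Fin.ext_iff]; omega, h.2.1⟩, h.2.2⟩) le_rfl

/-- After `k` rounds, the memory represents a state of the local search in which no exchange is
improving, or `k` exchanges have raised the sum of the cost ranks to at least `k`. -/
def RoundInvariant (f : Finset (Fin n) → ℝ) (c : Fin n → ℝ) (k₁ k₂ k : ℕ) (m : Memory) : Prop :=
  ∃ S α best out, Represents c S best out k₁ k₂ m ∧ SearchInvariant f c S α best out ∧
    ((∀ a b, ¬ f S < f (exchange S a b)) ∨ k ≤ rankSum c S)

theorem applyExchange_triple (a b : Fin n) :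
    applyExchange.Triple f
      (fun m => Represents c S best out k₁ k₂ m ∧ m.reg 8 = a ∧ m.reg 9 = b ∧
        m.real 8 0 = exchangeRatio f c S a b) 15
      (fun m => Represents c (exchange S a b) best out k₁ k₂ m ∧
        m.real 8 0 = exchangeRatio f c S a b ∧
        m.real 11 0 = (1 - exchangeRatio f c S a b) * f (exchange S a b)) := by
  refine Program.Triple.block fun m ⟨hr, ha, hb, hratio⟩ => ?_
  have hquery := actionSet_exchange hr.set a b
    (m' := (m.setArr 0 a 0).setArr 0 b 1) (by simp [Memory.setArr])
  obtain ⟨h1, h2, h3, h4, h5, h6, h7, h8, h9, h10, h11⟩ := hr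
  simp only [Memory.actionSet, Memory.setArr, Function.update_self, Function.update_idem, ne_eq]
    at hquery
  refine ⟨⟨?_, ?_, ?_, ?_, ?_, ?_, ?_, fun i => ?_, ?_, ?_, ?_⟩, ?_, ?_⟩
  case refine_8 =>
    simp only [Memory.setArr, Memory.set, Memory.get, Instruction.exec, scalar, List.foldl, ha, hb,
      h3, exchange, Finset.mem_insert, Finset.mem_erase]
    rcases eq_or_ne i b with rfl | hib
    · simp [h7]
    · rcases eq_or_ne i a with rfl | hia
      · simp [hib, Fin.val_inj]
      · simp [hib, hia, Fin.val_inj, h8]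
  all_goals
    simp [Memory.setArr, Memory.set, Memory.get, Instruction.exec, scalar, Memory.actionSet,
      ha, hb, h1, h2, h3, h4, h5, h7, h9, h10, h11, hratio, hquery]

theorem searchRound_triple (hf : IsSuccessProbability f) (hgs : GrossSubstitutes f)
    (hc : ∀ a, 0 < c a) {k : ℕ} :
    searchRound.Triple f (RoundInvariant f c k₁ k₂ k) (n * (n * 37 + 6) + 33)
      (RoundInvariant f c k₁ k₂ (k + 1)) := by
  rintro m ⟨S, α, best, out, hr, hs, hk⟩
  suffices h : searchRound.Triple f (Represents c S best out k₁ k₂) (n * (n * 37 + 6) + 33)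
    (RoundInvariant f c k₁ k₂ (k + 1)) from h m hr
  refine Program.Triple.imp (Program.Triple.seq (Program.Triple.block
    (B := Scanning f c S best out k₁ k₂ fun _ _ => False) ?_) (scan_triple.seq
    (Program.Triple.ite (t := 22) ?_ ?_))) (fun _ h => h) (fun _ h => h)
    (by simp only [List.length_cons, List.length_nil]; omega)
  · rintro m ⟨h1, h2, h3, h4, h5, h6, h7, h8, h9, h10, h11⟩
    refine ⟨⟨?_, ?_, ?_, ?_, ?_, h6, ?_, ?_, ?_, ?_, ?_⟩, ?_, Or.inl ⟨?_, fun _ _ => False.elim⟩⟩ <;>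
    simp [Memory.setReg, Memory.set, Instruction.exec, scalar, h1, h2, h3, h4, h5, h6, h7, h8, h9,
      h10, h11]
  · rintro m ⟨hscan, hfound⟩
    simp only [Test.Holds, hscan.represents.zero] at hfound
    rcases hscan.recorded with h | ⟨-, a, b, ha, hb, hlt, hratio, hmin⟩
    · exact absurd h.1 hfound.ne'
    obtain ⟨hs', hrank⟩ := hs.move hf hgs hc hlt (fun a' b' => hmin a' b' trivial) rfl
    have hk' : k + 1 ≤ rankSum c (exchange S a b) := by
      rcases hk with hk | hk
      · exact absurd hlt (hk a b)
      · omega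
    refine Program.Triple.seq (applyExchange_triple a b) (Program.Triple.ite (t := 5)
      (Program.Triple.block ?_) (Program.Triple.skip.imp (A := fun m => _) (fun _ h => h) ?_
      (by omega))) m ⟨hscan.represents, ha, hb, hratio⟩
    · rintro m ⟨⟨hr, h8, h11⟩, hbest⟩
      simp only [Test.Holds, Memory.get, scalar, hr.zero, hr.best, h11] at hbest
      rw [if_pos hbest, if_pos hbest] at hs'
      refine ⟨_, _, _, _, ?_, hs', Or.inr hk'⟩
      obtain ⟨h1, h2, h3, h4, h5, h6, h7, h8', h9, -, -⟩ := hr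
      refine ⟨h1, h2, h3, h4, h5, h6, ?_, ?_, ?_, ?_, ?_⟩ <;>
      simp [Memory.set, Memory.get, Instruction.exec, scalar, h3, h7, h8', h9, h8, h11]
    · rintro m ⟨⟨hr, h8, h11⟩, hbest⟩
      simp only [Test.Holds, Memory.get, scalar, hr.zero, hr.best, h11] at hbest
      rw [if_neg hbest, if_neg hbest] at hs'
      exact ⟨_, _, _, _, hr, hs', Or.inr hk'⟩
  · refine Program.Triple.skip.imp (A := fun m => _) (fun m h => h) ?_ (by omega)
    rintro m ⟨hscan, hfound⟩
    simp only [Test.Holds, hscan.represents.zero] at hfound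
    rcases hscan.recorded with h | h
    · exact ⟨S, α, best, out, hscan.represents, hs, Or.inl fun a b => h.2 a b trivial⟩
    · omega

theorem RoundInvariant.setReg {k : ℕ} {m : Memory} (h : RoundInvariant f c k₁ k₂ k m) (v : ℕ) :
    RoundInvariant f c v k₂ k (m.setReg 3 v) ∧ RoundInvariant f c k₁ v k (m.setReg 4 v) := by
  obtain ⟨S, α, best, out, h, h'⟩ := h
  obtain ⟨h1, h2, h3, h4, h5, h6, h7, h8, h9, h10, h11⟩ := h
  refine ⟨⟨S, α, best, out, ⟨?_, ?_, ?_, ?_, ?_, h6, h7, h8, h9, h10, h11⟩, h'⟩,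
    ⟨S, α, best, out, ⟨?_, ?_, ?_, ?_, ?_, h6, h7, h8, h9, h10, h11⟩, h'⟩⟩ <;>
  simp [Memory.setReg, *]

theorem searchProgram_triple (hf : IsSuccessProbability f) (hgs : GrossSubstitutes f)
    (hc : ∀ a, 0 < c a) :
    searchProgram.Triple f (fun m => m = Memory.initial c)
      (n * (n * (n * (n * 37 + 6) + 36) + 6) + 9)
      (fun m => ∃ o : ℝ≥0, m.real 1 0 = o ∧ o ≤ 1 ∧ IsOptimalContract f c (Contract.linear o)) := by
  have hinit : (block [.const 1 1, .realConst (scalar 9) 1]).Triple f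
      (fun m => m = Memory.initial c) 5 (fun m => ∃ k₁ k₂, RoundInvariant f c k₁ k₂ 0 m) := by
    refine Program.Triple.block fun m hm => ?_
    subst hm
    refine ⟨0, 0, ∅, 0, 0, 0, ⟨?_, ?_, ?_, ?_, ?_, ?_, ?_, ?_, ?_, ?_, ?_⟩,
      searchInvariant_initial hf hc, Or.inr (Nat.zero_le _)⟩ <;>
    simp [Memory.setReg, Memory.set, Memory.initial, Memory.actionSet, Instruction.exec, scalar]
  have hloop : (forLoop 3 (forLoop 4 searchRound)).Triple f
      (fun m => ∃ k₁ k₂, RoundInvariant f c k₁ k₂ 0 m)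
      (n * (n * (n * (n * 37 + 6) + 36) + 6) + 3)
      (fun m => ∃ k₁ k₂, RoundInvariant f c k₁ k₂ (n * n) m) := by
    have hreg : ∀ {k₁ k₂ k m}, RoundInvariant f c k₁ k₂ k m →
        m.reg 0 = n ∧ m.reg 1 = 1 ∧ m.reg 3 = k₁ ∧ m.reg 4 = k₂ := by
      rintro k₁ k₂ k m ⟨S, α, best, out, h, -⟩
      exact ⟨h.size, h.one, h.count₁, h.count₂⟩
    refine Program.Triple.forLoop (N := n)
      (J := fun i m => ∃ k₁ k₂, RoundInvariant f c k₁ k₂ (i * n) m)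
      (fun i m v ⟨k₁, k₂, h⟩ => ⟨v, k₂, (h.setReg v).1⟩)
      (fun i m ⟨k₁, k₂, h⟩ => ⟨(hreg h).1, (hreg h).2.1⟩) (fun i hi => ?_)
      (fun m h => by simpa using h) (fun m h => h)
    refine Program.Triple.forLoop (N := n)
      (J := fun j m => ∃ k₂, RoundInvariant f c i k₂ (i * n + j) m)
      (fun j m v ⟨k₂, h⟩ => ⟨v, (h.setReg v).2⟩)
      (fun j m ⟨k₂, h⟩ => ⟨(hreg h).1, (hreg h).2.1⟩) (fun j hj => ?_) ?_ ?_
    · refine (searchRound_triple (k₁ := i) (k₂ := j) (k := i * n + j) hf hgs hc).imp ?_ ?_ le_rfl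
      · rintro m ⟨⟨k₂, h⟩, hj⟩
        exact (hreg h).2.2.2.symm.trans hj ▸ h
      · exact fun m h => ⟨⟨j, h⟩, (hreg h).2.2.2⟩
    · rintro m ⟨⟨k₁, k₂, h⟩, hi⟩
      exact ⟨k₂, (hreg h).2.2.1.symm.trans hi ▸ h⟩
    · rintro m ⟨k₂, h⟩
      exact ⟨⟨i, k₂, by rwa [Nat.succ_mul]⟩, (hreg h).2.2.1⟩
  refine (hinit.seq hloop).imp (fun _ h => h) ?_ (by omega)
  rintro m ⟨k₁, k₂, S, α, best, out, hr, hs, hk⟩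
  rw [hr.out]
  exact hs.isOptimalContract hf hgs hc (hk.elim id (hs.not_lt_exchange hf hgs hc))

end Correctness

end CombinatorialContracts

/-- There is one program, for all numbers `n` of actions, that computes an optimal contract from the
costs and a value oracle for `f`, whenever `f` is a gross substitutes success probability function,
within a number of steps that is polynomial in `n`; and on rational data all real numbers that
occur during the computation are rational of polynomially bounded bit length. -/
theorem mainTheorem1 :
    ∃ (P : CombinatorialContracts.Program) (timeBound sizeBound : Polynomial ℕ),
      ∀ (n : ℕ) (f : Finset (Fin n) → ℝ) (c : Fin n → ℝ),
        CombinatorialContracts.IsSuccessProbability f →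
        CombinatorialContracts.GrossSubstitutes f →
        (∀ a, 0 < c a) →
        (∃ T : ℕ, T ≤ timeBound.eval n ∧ (P.run f c T).Halted ∧
          ∃ α : ℝ≥0, (P.run f c T).output = (α : ℝ) ∧ α ≤ 1 ∧
            CombinatorialContracts.IsOptimalContract f c
              (CombinatorialContracts.Contract.linear α)) ∧
        (∀ L : ℕ,
          (∀ S, CombinatorialContracts.HasBitLength (f S) L) →
          (∀ a, CombinatorialContracts.HasBitLength (c a) L) →
          ∀ T r i : ℕ, CombinatorialContracts.HasBitLength ((P.run f c T).mem.real r i)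
            (sizeBound.eval (n + L))) := by
  open CombinatorialContracts Polynomial in
  refine ⟨searchProgram, X * (X * (X * (X * 37 + 6) + 36) + 6) + 9, 16 * X + 31,
    fun n f c hf hgs hc => ⟨?_, fun L hfL hcL T r i => ?_⟩⟩
  · obtain ⟨s, hs, m, hrun, o, ho⟩ := searchProgram_triple hf hgs hc _ rfl
    refine ⟨s, by simpa using hs, ?_⟩
    rw [Program.run, hrun []]
    exact ⟨rfl, o, ho⟩
  · -- The additional digit covers the constant `1`, which has level `0`.
    have h := searchProgram_levelled.fractionBound_run (Nat.succ_pos L)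
      (fun S => (hfL S).fractionBound.mono (Nat.le_succ L))
      (fun a => (hcL a).fractionBound.mono (Nat.le_succ L)) T r i
    refine (h.mono ((levelBound_mono _ (searchLevel_le r)).trans ?_)).hasBitLength
    simp [levelBound]
    omega
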